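/- **Setting.** Let $\mathbb F_2$ be the field with two elements, $R_{2n}$ the $2n\times 2n$ reverse diagonal matrix (ones exactly on the antidiagonal), and $\mathrm{Sp}_{2n}=\{C\in\mathbb F_2^{2n\times 2n}: C^\top R_{2n}C=R_{2n}\}$. Let $0\le\delta\le 3/4$ and let the random vector $U\in\mathbb F_2^{2n}$ describe the Pauli error of $n$ independent qubit depolarizing channels with parameter $\delta$: the pairs $(U_i,U_{2n+1-i})$, $i=1,\dots,n$, are independent, equal to $(0,0)$ with probability $1-\delta$ and to each of the other three values with probability $\delta/3$. Let $p_U$ be the law of $U$. For $n=m+k$, $C\in\mathrm{Sp}_{2n}$ and a decoder $D:\mathbb F_2^m\to\mathbb F_2^{2n}$, the probability of guessing incorrectly is $\Pr[D((CU)_1,\dots,(CU)_m)\ne U]$. For $\epsilon>0$, the optimal error-guessing rate $R(p_U,\epsilon)$ is the maximum of $k/n$ over all $0\le k\le n$ for which some pair $C,D$ with $m=n-k$ guesses incorrectly with probability at most $\epsilon$ (it is defined when there is at least one such $k$). List the $4^n$ vectors of $\mathbb F_2^{2n}$ in decreasing order of probability under $p_U$, with ties resolved arbitrarily, and let $J\in\{1,\dots,4^n\}$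 be the position of $U$ in the list. For $r=k/n$ and $m=n-k$, the converse and achievability bounds on the error probability are $$\underline{\varepsilon}(p_U,r)=\Pr[J>2^m],\qquad \overline{\varepsilon}(p_U,r)=\Pr[J>2^m]+\mathbb E\big[\mathbf 1_{J\le 2^m}(J-1)2^{-m}\big].$$ Let $B(n,p,i)=\sum_{j=0}^{i}\binom nj p^j(1-p)^{n-j}$ be the binomial CDF, extended to the piecewise linear function of a real argument whose graph on $[-1,n]$ connects $(-1,0),(0,B(n,p,0)),\dots,(n,B(n,p,n))$; for $0<p<1$ let $B^{-1}(n,p,\cdot):[0,1]\to[-1,n]$ be its inverse. Let $\Phi$ be the standard normal CDF and $h(\delta)=-\delta\log_2\delta-(1-\delta)\log_2(1-\delta)$. **Theorem.** Let $0\le\delta\le 3/4$. (1) For all $n\ge1$ and $0\le k\le n$, with $r=k/n$, $m=n-k$ and $\ell=B^{-1}\!\left(n,\tfrac34,\tfrac{2^m}{4^n}\right)$, $$\underline{\varepsilon}(p_U,r)=B(n,1-\delta,n-1-\ell)$$ and $$\overline{\varepsilon}(p_U,r)=\Big(1+\frac1{2^{m+1}}\Big)B(n,1-\delta,n-1-\ell)-\frac1{2^{m+1}}+2^{m-1}(1-\delta)^n\Big(\frac{\delta}{3-3\delta}\Big)^{\lfloor\ell\rfloor+1}+\frac{(16-16\delta)^n}{2^{m+1}}\Big(\frac{3-4\delta}{3-3\delta}\Big)\sum_{i=0}^{\lfloor\ell\rfloor}\Big(\frac{\delta}{3-3\delta}\Big)^i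 B\big(n,\tfrac34,i\big)^2 .$$ (2) Let $\delta>0$ and $0<\epsilon<1$ be fixed. If $1-h(\delta)-\delta\log_2 3>0$, then $R(p_U,\epsilon)$ is defined for all sufficiently large $n$. Moreover, there are constants $K$ and $N$, depending only on $\delta$ and $\epsilon$, such that for every $n\ge N$ for which $R(p_U,\epsilon)$ is defined (whatever the sign of $1-h(\delta)-\delta\log_2 3$), $$\left|R(p_U,\epsilon)-\left(1-h(\delta)-\delta\log_2 3-\sqrt{\frac{\delta(1-\delta)}{n}}\,\Phi^{-1}(\epsilon)\log_2\frac{\delta}{3(1-\delta)}+\frac{\log_2 n}{2n}\right)\right|\le\frac Kn .$$ -/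

import Mathlib

open scoped Matrix
open Finset

noncomputable section

namespace PauliGuess

/-- Column vectors in `𝔽₂^{2n}`, the values of a Pauli error on `n` qubits. -/
abbrev PVec (n : ℕ) : Type := Fin (2 * n) → ZMod 2

/-- The `N × N` reverse diagonal matrix over `𝔽₂` (ones exactly on the antidiagonal). -/
def revDiag (N : ℕ) : Matrix (Fin N) (Fin N) (ZMod 2) :=
  Matrix.of fun i j => if j = i.rev then 1 else 0

/-- The symplectic group: the `2n × 2n` matrices `C` over `𝔽₂` with `Cᵀ R C = R`,
where `R` is the reverse diagonal matrix. -/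
def symplecticSet (n : ℕ) : Set (Matrix (Fin (2 * n)) (Fin (2 * n)) (ZMod 2)) :=
  {C | Cᵀ * revDiag (2 * n) * C = revDiag (2 * n)}

/-- The syndrome of `u`: the first `m` coordinates of `C u`. -/
def syndrome {n m : ℕ} (hm : m ≤ n) (C : Matrix (Fin (2 * n)) (Fin (2 * n)) (ZMod 2))
    (u : PVec n) : Fin m → ZMod 2 :=
  fun i => (C *ᵥ u) (Fin.castLE (hm.trans (Nat.le_mul_of_pos_left n two_pos)) i)

/-- For a random vector `U` with probability mass function `p`, the probability that the decoder
`D`, given the `m`-bit syndrome of `U` under `C`, does not output `U`. -/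
def guessErrorProb {n m : ℕ} (hm : m ≤ n) (p : PVec n → ℝ)
    (C : Matrix (Fin (2 * n)) (Fin (2 * n)) (ZMod 2)) (D : (Fin m → ZMod 2) → PVec n) : ℝ :=
  ∑ u with D (syndrome hm C u) ≠ u, p u

/-- The rates `k / n` (with `n = m + k`) for which some pair `C, D` using `m` syndrome bits guesses
`U` incorrectly with probability at most `ε`. -/
def guessRates {n : ℕ} (p : PVec n → ℝ) (ε : ℝ) : Set ℝ :=
  {r | ∃ (m k : ℕ) (h : m + k = n), r = (k : ℝ) / n ∧
    ∃ C ∈ symplecticSet n, ∃ D : (Fin m → ZMod 2) → PVec n,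
      guessErrorProb (h ▸ Nat.le_add_right m k) p C D ≤ ε}

/-- `R` is the optimal error-guessing rate: the maximum of the rates above. -/
def IsErrorGuessRate {n : ℕ} (p : PVec n → ℝ) (ε R : ℝ) : Prop :=
  IsGreatest (guessRates p ε) R

/-- `o` lists the `2^{2n}` vectors in decreasing order of probability (ties in any way);
position `j` of the list, counted from `1`, is `o ⟨j - 1, _⟩`. -/
def IsSortedOrder {n : ℕ} (p : PVec n → ℝ) (o : Fin (2 ^ (2 * n)) ≃ PVec n) : Prop :=
  Antitone fun j => p (o j)

/-- The position, counted from `1`, of `u` in the list `o`; the random variable `J` is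
`position o U`. -/
def position {n : ℕ} (o : Fin (2 ^ (2 * n)) ≃ PVec n) (u : PVec n) : ℕ :=
  (o.symm u : ℕ) + 1

/-- The converse bound on the error probability with `m` syndrome bits, `P(J > 2^m)`. -/
def errorConverse {n : ℕ} (p : PVec n → ℝ) (o : Fin (2 ^ (2 * n)) ≃ PVec n) (m : ℕ) : ℝ :=
  ∑ u with 2 ^ m < position o u, p u

/-- The achievability bound on the error probability with `m` syndrome bits,
`P(J > 2^m) + E[1_{J ≤ 2^m} (J - 1) 2^{-m}]`. -/
def errorAchievability {n : ℕ} (p : PVec n → ℝ) (o : Fin (2 ^ (2 * n)) ≃ PVec n) (m : ℕ) : ℝ :=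
  (∑ u with 2 ^ m < position o u, p u)
    + ∑ u with position o u ≤ 2 ^ m, p u * (((position o u : ℝ) - 1) / 2 ^ m)

/-- The coordinate of a vector in `𝔽₂^{2n}` that holds the exponent of the Pauli `X` on qubit `i`.
The exponent of `Z` on qubit `i` is at the mirror image `(xPos i).rev`. -/
def xPos {n : ℕ} (i : Fin n) : Fin (2 * n) :=
  Fin.castLE (Nat.le_mul_of_pos_left n two_pos) i

/-- The law of the Pauli error `X^a Z^b` of one depolarizing channel
`ρ ↦ (1 - δ) ρ + (δ / 3) (X ρ X + Z ρ Z + X Z ρ Z X)`. -/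
def depolarizingLawOne (δ : ℝ) (a b : ZMod 2) : ℝ :=
  if a = 0 ∧ b = 0 then 1 - δ else δ / 3

/-- The law of the Pauli error of `n` independent depolarizing channels. -/
def depolarizingLaw (n : ℕ) (δ : ℝ) (u : PVec n) : ℝ :=
  ∏ i : Fin n, depolarizingLawOne δ (u (xPos i)) (u (xPos i).rev)

/-- The number of qubits on which the Pauli error `u` acts nontrivially. -/
def weight {n : ℕ} (u : PVec n) : ℕ :=
  #{i : Fin n | ¬ (u (xPos i) = 0 ∧ u (xPos i).rev = 0)}

theorem depolarizingLaw_eq (n : ℕ) (δ : ℝ) (u : PVec n) :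
    depolarizingLaw n δ u = (δ / 3) ^ weight u * (1 - δ) ^ (n - weight u) := by
  unfold depolarizingLaw depolarizingLawOne
  rw [Finset.prod_ite, Finset.prod_const, Finset.prod_const, mul_comm]
  have h := Finset.card_filter_add_card_filter_not (s := (Finset.univ : Finset (Fin n)))
    (fun i : Fin n => u (xPos i) = 0 ∧ u (xPos i).rev = 0)
  rw [Finset.card_univ, Fintype.card_fin] at h
  unfold weight
  congr 2
  omega

/-- The `Binomial(N, p)` cumulative distribution function at an integer `i` (it is `0` for `i < 0`
and `1` for `i ≥ N`). -/
def binCDFInt (N : ℕ) (p : ℝ) (i : ℤ) : ℝ :=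
  ∑ j ∈ Finset.range (i + 1).toNat, (N.choose j : ℝ) * p ^ j * (1 - p) ^ (N - j)

/-- The piecewise linear interpolation of the binomial CDF through its values at the integers;
on `[-1, N]` it runs through `(-1, 0), (0, F 0), …, (N, F N)`. -/
def binCDF (N : ℕ) (p x : ℝ) : ℝ :=
  binCDFInt N p ⌊x⌋ + Int.fract x * (binCDFInt N p (⌊x⌋ + 1) - binCDFInt N p ⌊x⌋)

/-- The inverse of the bijection `binCDF N p : [-1, N] → [0, 1]` (for `0 < p < 1`). -/
def binCDFInv (N : ℕ) (p : ℝ) : ℝ → ℝ :=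
  Function.invFunOn (binCDF N p) (Set.Icc (-1) (N : ℝ))

/-- The inverse, on `(0, 1)`, of the standard normal cumulative distribution function. -/
def normalCDFInv : ℝ → ℝ :=
  Function.invFun (ProbabilityTheory.cdf (ProbabilityTheory.gaussianReal 0 1))

/-- The binary entropy in bits. -/
def binEntropyTwo (δ : ℝ) : ℝ := -δ * Real.logb 2 δ - (1 - δ) * Real.logb 2 (1 - δ)

/-- The hashing bound `1 - h(δ) - δ log₂ 3` of the depolarizing channel. -/
def hashingBound (δ : ℝ) : ℝ := 1 - binEntropyTwo δ - δ * Real.logb 2 3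

end PauliGuess

end

/-!
The probability of a Pauli error depends on its weight only, so a list in decreasing order of
probability runs through the weights in increasing order, and the vectors of weight less than `i`
are counted by the distribution function of `Binomial(n, 3/4)`. The error bounds are then sums over
blocks of equal weight; Abel summation brings the achievability bound to its closed form.

A syndrome of `m` bits leads to at most `2 ^ m` correctly guessed vectors, which bounds the success
probability of every decoder. Conversely, the symplectic group acts transitively on the nonzero
vectors, so under a random symplectic map a fixed nonzero vector has zero syndrome with probability
at most `2 ^ (-m)`; a decoder that returns a lightest vector of the given syndrome errs on `u` only
if some nonzero difference `u - v`, with `v` no heavier than `u`, has zero syndrome. The union bound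
thus has error about `E[min(1, N(w) / 2 ^ m)]`, where `w` is the weight of the error and `N(w)`
counts the vectors of weight at most `w`.

Both bounds say that `2 ^ m` is, up to a constant factor, the number of vectors of weight at most a
quantile `t` of the `Binomial(n, δ)` weight. The Berry–Esseen theorem, a case of Stein's method,
locates `t` up to a bounded error, and local bounds of order `1 / √n` on the binomial probabilities
account for the `log n` term of the rate.
-/

noncomputable section

namespace PauliGuess

open ProbabilityTheory MeasureTheory Filter Topology

/-! ### The standard normal distribution -/

/-- The standard normal cumulative distribution function. -/
def normalCDF (x : ℝ) : ℝ := cdf (gaussianReal 0 1) x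

/-- The standard normal density. -/
def normalPDF (x : ℝ) : ℝ := gaussianPDFReal 0 1 x

theorem normalPDF_pos (x : ℝ) : 0 < normalPDF x := gaussianPDFReal_pos 0 1 x one_ne_zero

theorem normalPDF_eq (x : ℝ) :
    normalPDF x = (√(2 * Real.pi))⁻¹ * Real.exp (-x ^ 2 / 2) := by
  simp [normalPDF, gaussianPDFReal]

theorem normalPDF_le_of_abs_le {x y : ℝ} (h : |x| ≤ |y|) : normalPDF y ≤ normalPDF x := by
  rw [normalPDF_eq, normalPDF_eq]
  have := sq_le_sq.2 h
  gcongr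

theorem normalPDF_neg (x : ℝ) : normalPDF (-x) = normalPDF x := by simp [normalPDF_eq]

theorem hasDerivAt_normalPDF (x : ℝ) : HasDerivAt normalPDF (-(x * normalPDF x)) x := by
  have hexp : HasDerivAt (fun y : ℝ => (√(2 * Real.pi))⁻¹ * Real.exp (-y ^ 2 / 2))
      ((√(2 * Real.pi))⁻¹ * (Real.exp (-x ^ 2 / 2) * (-(2 * x) / 2))) x := by
    refine HasDerivAt.const_mul _ (HasDerivAt.exp ?_)
    simpa using ((hasDerivAt_pow 2 x).neg).div_const 2
  rw [funext normalPDF_eq]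
  exact hexp.congr_deriv (by ring)

theorem continuous_normalPDF : Continuous normalPDF :=
  continuous_iff_continuousAt.2 fun x => (hasDerivAt_normalPDF x).continuousAt

theorem normalCDF_nonneg (x : ℝ) : 0 ≤ normalCDF x := cdf_nonneg _ x

theorem normalCDF_le_one (x : ℝ) : normalCDF x ≤ 1 := cdf_le_one _ x

theorem normalCDF_mono : Monotone normalCDF := monotone_cdf _

theorem normalCDF_eq_integral (x : ℝ) : normalCDF x = ∫ y in Set.Iic x, normalPDF y := by
  rw [normalCDF, cdf_eq_real, measureReal_def,
    gaussianReal_apply_eq_integral 0 one_ne_zero, ENNReal.toReal_ofReal]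
  · rfl
  · exact integral_nonneg fun y => (normalPDF_pos y).le

theorem normalCDF_sub_normalCDF (a b : ℝ) :
    normalCDF b - normalCDF a = ∫ y in a..b, normalPDF y := by
  rw [normalCDF_eq_integral, normalCDF_eq_integral]
  exact intervalIntegral.integral_Iic_sub_Iic (integrable_gaussianPDFReal 0 1).integrableOn
    (integrable_gaussianPDFReal 0 1).integrableOn

theorem hasDerivAt_normalCDF (x : ℝ) : HasDerivAt normalCDF (normalPDF x) x := by
  have hprimitive := (intervalIntegral.integral_hasDerivAt_right (a := 0) (b := x)
    (continuous_normalPDF.intervalIntegrable 0 x)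
    (continuous_normalPDF.stronglyMeasurableAtFilter _ _)
    continuous_normalPDF.continuousAt).add_const (normalCDF 0)
  refine hprimitive.congr_of_eventuallyEq (Eventually.of_forall fun y => ?_)
  simp only [← normalCDF_sub_normalCDF, sub_add_cancel]

theorem continuous_normalCDF : Continuous normalCDF :=
  continuous_iff_continuousAt.2 fun x => (hasDerivAt_normalCDF x).continuousAt

theorem normalCDF_neg (x : ℝ) : normalCDF (-x) = 1 - normalCDF x := by
  have hreflect := integral_comp_neg_Iic x normalPDF
  simp only [normalPDF_neg] at hreflect
  have htotal : (∫ y in Set.Iic (-x), normalPDF y) + ∫ y in Set.Ioi (-x), normalPDF y = 1 := by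
    rw [← integral_gaussianPDFReal_eq_one 0 (one_ne_zero (α := NNReal)), ← Set.compl_Iic]
    exact integral_add_compl measurableSet_Iic (integrable_gaussianPDFReal 0 1)
  rw [normalCDF_eq_integral, normalCDF_eq_integral, hreflect]
  linarith

theorem normalCDF_normalCDFInv {y : ℝ} (h0 : 0 < y) (h1 : y < 1) :
    normalCDF (normalCDFInv y) = y := by
  have hbot : Tendsto normalCDF atBot (𝓝 0) := tendsto_cdf_atBot _
  have htop : Tendsto normalCDF atTop (𝓝 1) := tendsto_cdf_atTop _
  obtain ⟨a, ha⟩ := (hbot.eventually_lt_const h0).exists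
  obtain ⟨b, hb⟩ := (htop.eventually_const_lt h1).exists
  exact Function.invFun_eq (f := normalCDF)
    (mem_range_of_exists_le_of_exists_ge continuous_normalCDF ⟨a, ha.le⟩ ⟨b, hb.le⟩)

theorem mul_one_sub_normalCDF_le (w : ℝ) : w * (1 - normalCDF w) ≤ normalPDF w := by
  have hderiv (x : ℝ) : HasDerivAt (fun x => normalPDF x - w * (1 - normalCDF x))
      (-(x * normalPDF x) - w * (-normalPDF x)) x :=
    (hasDerivAt_normalPDF x).sub (((hasDerivAt_normalCDF x).const_sub 1).const_mul w)
  have hanti : AntitoneOn (fun x => normalPDF x - w * (1 - normalCDF x)) (Set.Ici w) := by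
    refine antitoneOn_of_hasDerivWithinAt_nonpos (convex_Ici w)
      (fun x _ => (hderiv x).continuousAt.continuousWithinAt)
      (fun x _ => (hderiv x).hasDerivWithinAt) fun x hx => ?_
    rw [interior_Ici, Set.mem_Ioi] at hx
    nlinarith [normalPDF_pos x]
  have hlim : Tendsto (fun x => -(w * (1 - normalCDF x))) atTop (𝓝 (-(w * (1 - 1)))) :=
    ((tendsto_const_nhds.sub (tendsto_cdf_atTop (gaussianReal 0 1))).const_mul w).neg
  have hnonneg : -(w * (1 - 1)) ≤ normalPDF w - w * (1 - normalCDF w) := by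
    refine le_of_tendsto hlim ?_
    filter_upwards [eventually_ge_atTop w] with x hx
    linarith [hanti Set.self_mem_Ici (Set.mem_Ici.2 hx) hx, normalPDF_pos x]
  linarith

/-! ### Stein's method for the normal distribution -/

/-- A bound on the solutions of Stein's equation. -/
def steinBound : ℝ := 1 + 1 / normalPDF 1

theorem one_le_steinBound : 1 ≤ steinBound :=
  le_add_of_nonneg_right (one_div_pos.2 (normalPDF_pos 1)).le

theorem one_sub_normalCDF_div_normalPDF_le {w : ℝ} (hw : 0 ≤ w) :
    (1 - normalCDF w) / normalPDF w ≤ steinBound := by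
  have hpos : 0 < 1 / normalPDF 1 := one_div_pos.2 (normalPDF_pos 1)
  have hle_one := normalCDF_le_one w
  unfold steinBound
  rcases le_total 1 w with h | h
  · have : (1 - normalCDF w) / normalPDF w ≤ 1 := by
      rw [div_le_one (normalPDF_pos w)]
      nlinarith [mul_one_sub_normalCDF_le w]
    linarith
  · have : (1 - normalCDF w) / normalPDF w ≤ 1 / normalPDF 1 :=
      div_le_div₀ zero_le_one (by linarith [normalCDF_nonneg w]) (normalPDF_pos 1)
        (normalPDF_le_of_abs_le (by rwa [abs_of_nonneg hw, abs_one]))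
    linarith

/-- The bounded solution `f` of Stein's equation `f' w = w f w + 1_{w ≤ z} - Φ z`. -/
def steinSol (z w : ℝ) : ℝ := normalCDF (min w z) * (1 - normalCDF (max w z)) / normalPDF w

theorem steinSol_nonneg (z w : ℝ) : 0 ≤ steinSol z w :=
  div_nonneg (mul_nonneg (normalCDF_nonneg _) (sub_nonneg.2 (normalCDF_le_one _)))
    (normalPDF_pos w).le

theorem steinSol_le (z w : ℝ) : steinSol z w ≤ (1 - normalCDF |w|) / normalPDF |w| := by
  unfold steinSol
  rcases le_total 0 w with hw | hw
  · rw [abs_of_nonneg hw]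
    refine div_le_div_of_nonneg_right ?_ (normalPDF_pos w).le
    have := normalCDF_mono (le_max_left w z)
    nlinarith [normalCDF_le_one (min w z), normalCDF_nonneg (min w z), normalCDF_le_one (max w z)]
  · rw [abs_of_nonpos hw, normalPDF_neg, normalCDF_neg, sub_sub_cancel]
    refine div_le_div_of_nonneg_right ?_ (normalPDF_pos w).le
    have := normalCDF_mono (min_le_left w z)
    nlinarith [normalCDF_nonneg (max w z), normalCDF_nonneg (min w z), normalCDF_le_one (max w z)]

theorem abs_steinSol_le (z w : ℝ) : |steinSol z w| ≤ steinBound := by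
  rw [abs_of_nonneg (steinSol_nonneg z w)]
  exact (steinSol_le z w).trans (one_sub_normalCDF_div_normalPDF_le (abs_nonneg w))

theorem abs_mul_steinSol_le_one (z w : ℝ) : |w * steinSol z w| ≤ 1 := by
  rw [abs_mul, abs_of_nonneg (steinSol_nonneg z w)]
  calc |w| * steinSol z w ≤ |w| * ((1 - normalCDF |w|) / normalPDF |w|) := by
        gcongr
        exact steinSol_le z w
    _ = |w| * (1 - normalCDF |w|) / normalPDF |w| := (mul_div_assoc ..).symm
    _ ≤ 1 := (div_le_one (normalPDF_pos _)).2 (mul_one_sub_normalCDF_le |w|)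

theorem continuous_steinSol (z : ℝ) : Continuous (steinSol z) :=
  ((continuous_normalCDF.comp (continuous_id.min continuous_const)).mul
    (continuous_const.sub (continuous_normalCDF.comp (continuous_id.max continuous_const)))).div
      continuous_normalPDF fun w => (normalPDF_pos w).ne'

theorem hasDerivAt_add_mul_normalCDF_div (a b w : ℝ) :
    HasDerivAt (fun w => (a + b * normalCDF w) / normalPDF w)
      (w * ((a + b * normalCDF w) / normalPDF w) + b) w := by
  have hpdf := (normalPDF_pos w).ne'
  refine ((((hasDerivAt_normalCDF w).const_mul b).const_add a).div
    (hasDerivAt_normalPDF w) hpdf).congr_deriv ?_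
  field_simp
  ring

theorem hasDerivWithinAt_steinSol (z w : ℝ) :
    HasDerivWithinAt (steinSol z)
      (w * steinSol z w + ((if w < z then 1 else 0) - normalCDF z)) (Set.Ici w) w := by
  rcases lt_or_ge w z with h | h
  · have heq : steinSol z =ᶠ[𝓝 w]
        fun y => (0 + (1 - normalCDF z) * normalCDF y) / normalPDF y := by
      filter_upwards [Iio_mem_nhds h] with y hy
      rw [steinSol, min_eq_left (le_of_lt hy), max_eq_right (le_of_lt hy), zero_add, mul_comm]
    rw [if_pos h, heq.eq_of_nhds]
    exact ((hasDerivAt_add_mul_normalCDF_div _ _ w).congr_of_eventuallyEq heq).hasDerivWithinAt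
  · have heq : Set.EqOn (steinSol z)
        (fun y => (normalCDF z + -normalCDF z * normalCDF y) / normalPDF y) (Set.Ici w) := by
      intro y hy
      rw [steinSol, min_eq_right (h.trans hy), max_eq_left (h.trans hy)]
      ring
    rw [if_neg h.not_gt, zero_sub, heq Set.self_mem_Ici]
    exact (hasDerivAt_add_mul_normalCDF_div _ _ w).hasDerivWithinAt.congr heq
      (heq Set.self_mem_Ici)

theorem abs_ite_sub_normalCDF_le_one (P : Prop) [Decidable P] (z : ℝ) :
    |(if P then 1 else 0) - normalCDF z| ≤ 1 := by
  have := normalCDF_nonneg z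
  have := normalCDF_le_one z
  rw [abs_le]
  split_ifs <;> constructor <;> linarith

theorem abs_mul_steinSol_add_le_two (P : Prop) [Decidable P] (z w : ℝ) :
    |w * steinSol z w + ((if P then 1 else 0) - normalCDF z)| ≤ 2 := by
  linarith [abs_add_le (w * steinSol z w) ((if P then 1 else 0) - normalCDF z),
    abs_mul_steinSol_le_one z w, abs_ite_sub_normalCDF_le_one P z]

theorem abs_steinSol_sub_le {a b : ℝ} (z : ℝ) (hab : a ≤ b) :
    |steinSol z b - steinSol z a| ≤ 2 * (b - a) :=
  norm_image_sub_le_of_norm_deriv_right_le_segment (continuous_steinSol z).continuousOn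
    (fun w _ => hasDerivWithinAt_steinSol z w)
    (fun w _ => abs_mul_steinSol_add_le_two (w < z) z w) b (Set.right_mem_Icc.2 hab)

theorem abs_mul_steinSol_sub_le {a b : ℝ} (z : ℝ) (hab : a ≤ b) :
    |b * steinSol z b - a * steinSol z a| ≤ (2 * |a| + steinBound) * (b - a) :=
  calc |b * steinSol z b - a * steinSol z a|
      = |a * (steinSol z b - steinSol z a) + (b - a) * steinSol z b| := by ring_nf
    _ ≤ |a| * |steinSol z b - steinSol z a| + (b - a) * |steinSol z b| := by
        refine (abs_add_le _ _).trans_eq ?_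
        rw [abs_mul, abs_mul, abs_of_nonneg (sub_nonneg.2 hab)]
    _ ≤ |a| * (2 * (b - a)) + (b - a) * steinBound := by
        have := sub_nonneg.2 hab
        gcongr
        exacts [abs_steinSol_sub_le z hab, abs_steinSol_le z b]
    _ = (2 * |a| + steinBound) * (b - a) := by ring

theorem abs_steinSol_sub_sub_le_of_not_between {z a b : ℝ} (hab : a ≤ b)
    (hz : ¬(a ≤ z ∧ z < b)) :
    |steinSol z b - steinSol z a -
        (b - a) * (a * steinSol z a + ((if a ≤ z then 1 else 0) - normalCDF z))| ≤
      (b - a) * ((2 * |a| + steinBound) * (b - a)) := by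
  set c := a * steinSol z a + ((if a ≤ z then 1 else 0) - normalCDF z) with hc
  have hderiv (w : ℝ) (hw : w ∈ Set.Ico a b) : HasDerivWithinAt (fun w => steinSol z w - w * c)
      (w * steinSol z w - a * steinSol z a) (Set.Ici w) w := by
    have hside : w < z ↔ a ≤ z :=
      ⟨fun h => hw.1.trans h.le, fun h => hw.2.trans_le (not_lt.1 fun h' => hz ⟨h, h'⟩)⟩
    refine ((hasDerivWithinAt_steinSol z w).sub
      ((hasDerivWithinAt_id w _).mul_const c)).congr_deriv ?_
    simp only [hside, hc]
    ring
  have hbound (w : ℝ) (hw : w ∈ Set.Ico a b) :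
      |w * steinSol z w - a * steinSol z a| ≤ (2 * |a| + steinBound) * (b - a) := by
    refine (abs_mul_steinSol_sub_le z hw.1).trans ?_
    have := one_le_steinBound
    gcongr
    exact hw.2.le
  have hcont : Continuous fun w => steinSol z w - w * c :=
    (continuous_steinSol z).sub (continuous_id.mul continuous_const)
  calc |steinSol z b - steinSol z a - (b - a) * c|
      = |(steinSol z b - b * c) - (steinSol z a - a * c)| := by ring_nf
    _ ≤ (2 * |a| + steinBound) * (b - a) * (b - a) :=
        norm_image_sub_le_of_norm_deriv_right_le_segment hcont.continuousOn hderiv hbound b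
          (Set.right_mem_Icc.2 hab)
    _ = (b - a) * ((2 * |a| + steinBound) * (b - a)) := mul_comm _ _

theorem abs_steinSol_sub_sub_le {a b : ℝ} (z : ℝ) (hab : a ≤ b) :
    |steinSol z b - steinSol z a -
        (b - a) * (a * steinSol z a + ((if a ≤ z then 1 else 0) - normalCDF z))| ≤
      (b - a) * ((2 * |a| + steinBound) * (b - a) + 4 * if a ≤ z ∧ z < b then 1 else 0) := by
  have hlen := sub_nonneg.2 hab
  have hcoef : 0 ≤ (2 * |a| + steinBound) * (b - a) := by
    have := one_le_steinBound
    positivity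
  by_cases hz : a ≤ z ∧ z < b
  · have h := mul_le_mul_of_nonneg_left (abs_mul_steinSol_add_le_two (a ≤ z) z a) hlen
    rw [if_pos hz]
    refine (abs_sub _ _).trans ?_
    rw [abs_mul, abs_of_nonneg hlen]
    nlinarith [abs_steinSol_sub_le z hab, mul_nonneg hlen hcoef]
  · rw [if_neg hz, mul_zero, add_zero]
    exact abs_steinSol_sub_sub_le_of_not_between hab hz

/-! ### Binomial expectations -/

/-- The expectation of `g S` for a `Binomial(n, p)` random variable `S`, as a finite sum; `p` is
not required to be a probability. -/
def binE (n : ℕ) (p : ℝ) (g : ℕ → ℝ) : ℝ :=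
  ∑ k ∈ range (n + 1), (n.choose k : ℝ) * p ^ k * (1 - p) ^ (n - k) * g k

/-- The probability that a `Binomial(n, p)` random variable is at most `t`. -/
def binProbLE (n : ℕ) (p t : ℝ) : ℝ := binE n p fun k => if (k : ℝ) ≤ t then 1 else 0

/-- The standard deviation of the `Binomial(n, p)` distribution. -/
def binSD (n : ℕ) (p : ℝ) : ℝ := √(n * p * (1 - p))

/-- The value `(k - n p) / √(n p (1 - p))` of the standardized `Binomial(n, p)` variable. -/
def stdize (n : ℕ) (p : ℝ) (k : ℕ) : ℝ := (k - n * p) / binSD n p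

section Expectation

variable (n : ℕ) (p : ℝ)

theorem binE_add (g h : ℕ → ℝ) : binE n p (fun k => g k + h k) = binE n p g + binE n p h := by
  simp only [binE, ← sum_add_distrib, mul_add]

theorem binE_sub (g h : ℕ → ℝ) : binE n p (fun k => g k - h k) = binE n p g - binE n p h := by
  simp only [binE, ← sum_sub_distrib, mul_sub]

theorem binE_const_mul (c : ℝ) (g : ℕ → ℝ) : binE n p (fun k => c * g k) = c * binE n p g := by
  simp only [binE, mul_sum, mul_left_comm]

theorem binE_const (c : ℝ) : binE n p (fun _ => c) = c := by
  have hbinomial := add_pow p (1 - p) n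
  rw [add_sub_cancel, one_pow] at hbinomial
  rw [binE, ← sum_mul]
  conv_rhs => rw [← one_mul c, hbinomial]
  exact congrArg (· * c) (sum_congr rfl fun k _ => by ring)

theorem binE_ite_eq (i : ℕ) :
    binE n p (fun k => if k = i then 1 else 0) = (n.choose i : ℝ) * p ^ i * (1 - p) ^ (n - i) := by
  simp only [binE, mul_ite, mul_one, mul_zero, sum_ite_eq', mem_range]
  split_ifs with h
  · rfl
  · rw [Nat.choose_eq_zero_of_lt (by omega), Nat.cast_zero, zero_mul, zero_mul]

theorem one_sub_mul_binE (g : ℕ → ℝ) :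
    (1 - p) * binE n p g = (1 - p) ^ (n + 1) * g 0 +
      ∑ k ∈ range (n + 1),
        (n.choose (k + 1) : ℝ) * p ^ (k + 1) * (1 - p) ^ (n - k) * g (k + 1) := by
  rw [sum_range_succ, Nat.choose_succ_self, binE, sum_range_succ', mul_add, mul_sum, add_comm]
  simp only [Nat.choose_zero_right, Nat.cast_one, pow_zero, Nat.sub_zero, Nat.cast_zero, zero_mul,
    add_zero]
  congr 1
  · ring
  · refine sum_congr rfl fun k hk => ?_
    have : n - k = n - (k + 1) + 1 := by have := mem_range.1 hk; omega
    rw [this]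
    ring

/-- Condition on the last of `n + 1` Bernoulli trials. -/
theorem binE_succ (g : ℕ → ℝ) :
    binE (n + 1) p g = p * binE n p (fun k => g (k + 1)) + (1 - p) * binE n p g := by
  rw [one_sub_mul_binE, binE, binE, sum_range_succ', mul_sum]
  simp only [Nat.choose_zero_right, Nat.cast_one, pow_zero, Nat.sub_zero, one_mul]
  rw [add_comm, add_left_comm, ← sum_add_distrib]
  congr 1
  refine sum_congr rfl fun k _ => ?_
  rw [Nat.choose_succ_succ, Nat.add_sub_add_right]
  push_cast
  ring

theorem binE_succ_id_mul (g : ℕ → ℝ) :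
    binE (n + 1) p (fun k => k * g k) = (n + 1) * p * binE n p (fun k => g (k + 1)) := by
  rw [binE, binE, sum_range_succ', mul_sum]
  simp only [Nat.cast_zero, zero_mul, mul_zero, add_zero]
  refine sum_congr rfl fun k _ => ?_
  have habsorb : ((n + 1).choose (k + 1) : ℝ) * (k + 1) = (n + 1) * n.choose k := by
    exact_mod_cast (Nat.add_one_mul_choose_eq n k).symm
  rw [Nat.add_sub_add_right]
  push_cast
  linear_combination p ^ (k + 1) * (1 - p) ^ (n - k) * g (k + 1) * habsorb

/-- Stein's identity for the binomial distribution. -/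
theorem binE_succ_sub_mean_mul (g : ℕ → ℝ) :
    binE (n + 1) p (fun k => (k - (n + 1) * p) * g k) =
      (n + 1) * p * (1 - p) * binE n p (fun k => g (k + 1) - g k) := by
  simp only [sub_mul, binE_sub, binE_const_mul, binE_succ_id_mul]
  rw [binE_succ]
  ring

theorem binSD_eq : binSD n p = √(p * (1 - p)) * √n := by
  rw [binSD, mul_assoc, mul_comm, Real.sqrt_mul' _ (Nat.cast_nonneg n)]

theorem binSD_le_binSD_succ : binSD n p ≤ binSD (n + 1) p := by
  rw [binSD_eq, binSD_eq]
  gcongr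
  exact n.le_succ

theorem stdize_succ_sub (k : ℕ) : stdize n p (k + 1) - stdize n p k = 1 / binSD n p := by
  rw [stdize, stdize, ← sub_div]
  push_cast
  ring

end Expectation

section Probability

variable {n : ℕ} {p : ℝ}

theorem binE_mono (h0 : 0 ≤ p) (h1 : p ≤ 1) {g h : ℕ → ℝ} (hgh : ∀ k ≤ n, g k ≤ h k) :
    binE n p g ≤ binE n p h := by
  have := sub_nonneg.2 h1
  refine sum_le_sum fun k hk => ?_
  gcongr
  exact hgh k (Nat.lt_succ_iff.1 (mem_range.1 hk))

theorem abs_binE_le (h0 : 0 ≤ p) (h1 : p ≤ 1) {g h : ℕ → ℝ} (hgh : ∀ k ≤ n, |g k| ≤ h k) :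
    |binE n p g| ≤ binE n p h := by
  rw [abs_le, neg_eq_neg_one_mul, ← binE_const_mul]
  constructor
  · exact binE_mono h0 h1 fun k hk => by linarith [(abs_le.1 (hgh k hk)).1]
  · exact binE_mono h0 h1 fun k hk => (le_abs_self _).trans (hgh k hk)

theorem abs_binE_succ_sub_le (h0 : 0 ≤ p) (h1 : p ≤ 1) (g : ℕ → ℝ) :
    |binE (n + 1) p g - binE n p g| ≤ binE n p fun k => |g (k + 1) - g k| := by
  have hstep : binE (n + 1) p g - binE n p g = p * binE n p fun k => g (k + 1) - g k := by
    rw [binE_succ, binE_sub]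
    ring
  rw [hstep, abs_mul, abs_of_nonneg h0]
  exact (mul_le_of_le_one_left (abs_nonneg _) h1).trans (abs_binE_le h0 h1 fun _ _ => le_rfl)

theorem binProbLE_nonneg (h0 : 0 ≤ p) (h1 : p ≤ 1) (t : ℝ) : 0 ≤ binProbLE n p t := by
  rw [← binE_const n p 0]
  exact binE_mono h0 h1 fun k _ => by split_ifs <;> norm_num

theorem binProbLE_le_one (h0 : 0 ≤ p) (h1 : p ≤ 1) (t : ℝ) : binProbLE n p t ≤ 1 := by
  conv_rhs => rw [← binE_const n p 1]
  exact binE_mono h0 h1 fun k _ => by split_ifs <;> norm_num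

theorem binSD_pos (hn : n ≠ 0) (h0 : 0 < p) (h1 : p < 1) : 0 < binSD n p := by
  have := sub_pos.2 h1
  exact Real.sqrt_pos.2 (by positivity)

theorem binSD_succ_sq (h0 : 0 ≤ p) (h1 : p ≤ 1) :
    binSD (n + 1) p ^ 2 = (n + 1) * p * (1 - p) := by
  have := sub_nonneg.2 h1
  rw [binSD, Real.sq_sqrt (by positivity), Nat.cast_succ]

theorem tendsto_binSD_atTop (h0 : 0 < p) (h1 : p < 1) :
    Tendsto (fun n : ℕ => binSD n p) atTop atTop := by
  simp only [binSD_eq]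
  exact (Real.tendsto_sqrt_atTop.comp tendsto_natCast_atTop_atTop).const_mul_atTop
    (Real.sqrt_pos.2 (mul_pos h0 (sub_pos.2 h1)))

theorem stdize_le_iff (hs : 0 < binSD n p) (k : ℕ) (z : ℝ) :
    stdize n p k ≤ z ↔ (k : ℝ) ≤ n * p + binSD n p * z := by
  rw [stdize, div_le_iff₀ hs, sub_le_iff_le_add', mul_comm z]

theorem binE_succ_stdize_mul (h0 : 0 < p) (h1 : p < 1) (g : ℕ → ℝ) :
    binE (n + 1) p (fun k => stdize (n + 1) p k * g k) =
      binSD (n + 1) p * binE n p fun k => g (k + 1) - g k := by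
  have hs := (binSD_pos n.succ_ne_zero h0 h1).ne'
  have hscale : (fun k => stdize (n + 1) p k * g k) =
      fun k : ℕ => (binSD (n + 1) p)⁻¹ * ((k - (n + 1) * p) * g k) := by
    funext k
    rw [stdize, Nat.cast_succ]
    ring
  rw [hscale, binE_const_mul, binE_succ_sub_mean_mul, ← binSD_succ_sq h0.le h1.le]
  field_simp

theorem binE_succ_stdize_sq (h0 : 0 < p) (h1 : p < 1) :
    binE (n + 1) p (fun k => stdize (n + 1) p k ^ 2) = 1 := by
  simp only [sq, binE_succ_stdize_mul h0 h1, stdize_succ_sub, binE_const]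
  exact mul_one_div_cancel (binSD_pos n.succ_ne_zero h0 h1).ne'

theorem binE_succ_abs_stdize_le_one (h0 : 0 < p) (h1 : p < 1) :
    binE (n + 1) p (fun k => |stdize (n + 1) p k|) ≤ 1 := by
  have hamgm := binE_mono h0.le h1.le (n := n + 1) (g := fun k => 2 * |stdize (n + 1) p k|)
    (h := fun k => stdize (n + 1) p k ^ 2 + 1) fun k _ => by
      nlinarith [sq_nonneg (|stdize (n + 1) p k| - 1), sq_abs (stdize (n + 1) p k)]
  rw [binE_add, binE_succ_stdize_sq h0 h1, binE_const, binE_const_mul] at hamgm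
  linarith

theorem binE_ite_eq_le_one_div_binSD_succ (h0 : 0 < p) (h1 : p < 1) (i : ℕ) :
    binE n p (fun k => if k = i then 1 else 0) ≤ 1 / binSD (n + 1) p := by
  have hdiff : (fun k => if k = i then (1 : ℝ) else 0) =
      fun k => (if i < k + 1 then 1 else 0) - if i < k then 1 else 0 := by
    funext k
    rcases lt_trichotomy i k with h | h | h
    · simp [h, h.ne', h.trans k.lt_succ_self]
    · simp [h]
    · simp [h.ne, show ¬ i < k + 1 by omega, h.not_gt]
  rw [hdiff, le_div_iff₀' (binSD_pos n.succ_ne_zero h0 h1),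
    ← binE_succ_stdize_mul h0 h1 fun k => if i < k then 1 else 0]
  refine (binE_mono h0.le h1.le fun k _ => ?_).trans (binE_succ_abs_stdize_le_one h0 h1)
  split_ifs
  · simpa using le_abs_self _
  · simp

theorem choose_mul_pow_le_one_div_binSD (hn : n ≠ 0) (h0 : 0 < p) (h1 : p < 1) (i : ℕ) :
    (n.choose i : ℝ) * p ^ i * (1 - p) ^ (n - i) ≤ 1 / binSD n p := by
  rw [← binE_ite_eq]
  exact (binE_ite_eq_le_one_div_binSD_succ h0 h1 i).trans
    (one_div_le_one_div_of_le (binSD_pos hn h0 h1) (binSD_le_binSD_succ n p))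

theorem binE_le_sum_div_binSD (hn : n ≠ 0) (h0 : 0 < p) (h1 : p < 1) {g : ℕ → ℝ}
    (hg : ∀ k, 0 ≤ g k) : binE n p g ≤ (∑ k ∈ range (n + 1), g k) / binSD n p := by
  rw [sum_div]
  refine sum_le_sum fun k _ => ?_
  rw [← one_div_mul_eq_div]
  exact mul_le_mul_of_nonneg_right (choose_mul_pow_le_one_div_binSD hn h0 h1 k) (hg k)

/-! ### The Berry–Esseen bound -/

theorem binE_stdize_le_and_lt_le (h0 : 0 < p) (h1 : p < 1) (z : ℝ) :
    binE n p (fun k => if stdize (n + 1) p k ≤ z ∧ z < stdize (n + 1) p (k + 1) then 1 else 0) ≤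
      1 / binSD (n + 1) p := by
  set t : ℝ := (n + 1 : ℕ) * p + binSD (n + 1) p * z
  refine (binE_mono h0.le h1.le fun k _ => ?_).trans (binE_ite_eq_le_one_div_binSD_succ h0 h1 ⌊t⌋₊)
  have hs := binSD_pos n.succ_ne_zero h0 h1
  split_ifs with hwindow hk hk
  · rfl
  · rw [stdize_le_iff hs, ← not_le, stdize_le_iff hs, not_le, Nat.cast_succ k] at hwindow
    exact absurd ((Nat.floor_eq_iff (k.cast_nonneg.trans hwindow.1)).2 hwindow).symm hk
  all_goals norm_num

theorem binE_abs_stdize_succ_le_two (h0 : 0 < p) (h1 : p < 1) (hs : 1 ≤ binSD (n + 1) p) :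
    binE n p (fun k => |stdize (n + 1) p k|) ≤ 2 := by
  have hshift := binE_mono h0.le h1.le (n := n) (g := fun k => |stdize (n + 1) p k| - 1)
    (h := fun k => |stdize (n + 1) p (k + 1)|) fun k _ => by
      have hstep : |stdize (n + 1) p (k + 1) - stdize (n + 1) p k| ≤ 1 := by
        rw [stdize_succ_sub, abs_of_nonneg (by positivity)]
        exact (div_le_one (by linarith)).2 hs
      linarith [abs_sub_abs_le_abs_sub (stdize (n + 1) p k) (stdize (n + 1) p (k + 1)),
        abs_sub_comm (stdize (n + 1) p k) (stdize (n + 1) p (k + 1))]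
  have hsucc := binE_succ_abs_stdize_le_one (n := n) h0 h1
  rw [binE_succ] at hsucc
  rw [binE_sub, binE_const] at hshift
  nlinarith

theorem binE_mul_abs_stdize_add_steinBound_le (h0 : 0 < p) (h1 : p < 1)
    (hs : 1 ≤ binSD (n + 1) p) :
    binE n p (fun k => (2 * |stdize (n + 1) p k| + steinBound) * (1 / binSD (n + 1) p)) ≤
      (4 + steinBound) / binSD (n + 1) p := by
  simp only [mul_comm _ (1 / binSD (n + 1) p)]
  rw [binE_const_mul, binE_add, binE_const_mul, binE_const, one_div_mul_eq_div]
  gcongr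
  linarith [binE_abs_stdize_succ_le_two h0 h1 hs]

theorem abs_binE_succ_stdize_mul_steinSol_sub_le (h0 : 0 < p) (h1 : p < 1)
    (hs : 1 ≤ binSD (n + 1) p) (z : ℝ) :
    |binE (n + 1) p (fun k => stdize (n + 1) p k * steinSol z (stdize (n + 1) p k)) -
      binE n p (fun k => stdize (n + 1) p k * steinSol z (stdize (n + 1) p k))| ≤
      (4 + steinBound) / binSD (n + 1) p := by
  refine (abs_binE_succ_sub_le h0.le h1.le _).trans (le_trans ?_
    (binE_mul_abs_stdize_add_steinBound_le h0 h1 hs))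
  refine binE_mono h0.le h1.le fun k _ => ?_
  rw [← stdize_succ_sub (n + 1) p k]
  refine abs_mul_steinSol_sub_le z (sub_nonneg.1 ?_)
  rw [stdize_succ_sub]
  positivity

theorem abs_binE_succ_stdize_le_sub_le (h0 : 0 < p) (h1 : p < 1) (z : ℝ) :
    |binE (n + 1) p (fun k => if stdize (n + 1) p k ≤ z then 1 else 0) -
      binE n p (fun k => if stdize (n + 1) p k ≤ z then 1 else 0)| ≤ 1 / binSD (n + 1) p := by
  refine (abs_binE_succ_sub_le h0.le h1.le _).trans (le_trans ?_
    (binE_stdize_le_and_lt_le h0 h1 z))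
  refine binE_mono h0.le h1.le fun k _ => ?_
  have hlt : stdize (n + 1) p k < stdize (n + 1) p (k + 1) := by
    have := binSD_pos n.succ_ne_zero h0 h1
    rw [← sub_pos, stdize_succ_sub]
    positivity
  rcases lt_or_ge z (stdize (n + 1) p (k + 1)) with hz | hz
  · by_cases hk : stdize (n + 1) p k ≤ z <;> simp [hz.not_ge, hk, hz]
  · simp [hz, hlt.le.trans hz, hz.not_gt]

theorem abs_binE_steinSol_equation_sub_le (h0 : 0 < p) (h1 : p < 1)
    (hs : 1 ≤ binSD (n + 1) p) (z : ℝ) :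
    |binE (n + 1) p (fun k => stdize (n + 1) p k * steinSol z (stdize (n + 1) p k)) -
      binE n p (fun k => stdize (n + 1) p k * steinSol z (stdize (n + 1) p k) +
        ((if stdize (n + 1) p k ≤ z then 1 else 0) - normalCDF z))| ≤
      (8 + steinBound) / binSD (n + 1) p := by
  set s := binSD (n + 1) p
  set x := stdize (n + 1) p
  have hs0 : 0 < s := one_pos.trans_le hs
  rw [binE_succ_stdize_mul h0 h1, ← binE_const_mul, ← binE_sub]
  have hpointwise (k : ℕ) : |s * (steinSol z (x (k + 1)) - steinSol z (x k)) -
      (x k * steinSol z (x k) + ((if x k ≤ z then 1 else 0) - normalCDF z))| ≤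
      (2 * |x k| + steinBound) * (1 / s) + 4 * if x k ≤ z ∧ z < x (k + 1) then 1 else 0 := by
    have hstep : x (k + 1) - x k = 1 / s := stdize_succ_sub (n + 1) p k
    have hstein := abs_steinSol_sub_sub_le z (sub_nonneg.1 (hstep.ge.trans' (by positivity)))
    rw [hstep, one_div_mul_eq_div, one_div_mul_eq_div, le_div_iff₀' hs0, ← abs_of_pos hs0,
      ← abs_mul, abs_of_pos hs0, mul_sub, mul_div_cancel₀ _ hs0.ne'] at hstein
    exact hstein
  refine (abs_binE_le h0.le h1.le fun k _ => hpointwise k).trans ?_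
  rw [binE_add, binE_const_mul]
  have hsplit : (8 + steinBound) / s = (4 + steinBound) / s + 4 * (1 / s) := by ring
  linarith [binE_mul_abs_stdize_add_steinBound_le h0 h1 hs,
    binE_stdize_le_and_lt_le (n := n) h0 h1 z]

theorem abs_binProbLE_sub_normalCDF_le (hn : n ≠ 0) (h0 : 0 < p) (h1 : p < 1) (z : ℝ) :
    |binProbLE n p (n * p + binSD n p * z) - normalCDF z| ≤ (13 + 2 * steinBound) / binSD n p := by
  have hs0 := binSD_pos hn h0 h1
  rcases lt_or_ge (binSD n p) 1 with hs | hs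
  · have hbig : 1 ≤ (13 + 2 * steinBound) / binSD n p := by
      rw [le_div_iff₀ hs0]
      linarith [one_le_steinBound]
    refine hbig.trans' (abs_sub_le_iff.2 ⟨?_, ?_⟩) <;>
    linarith [binProbLE_nonneg (n := n) h0.le h1.le (n * p + binSD n p * z), normalCDF_nonneg z,
      binProbLE_le_one (n := n) h0.le h1.le (n * p + binSD n p * z), normalCDF_le_one z]
  obtain ⟨n, rfl⟩ := Nat.exists_eq_succ_of_ne_zero hn
  rw [Nat.succ_eq_add_one] at *
  have hequation := abs_le.1 (abs_binE_steinSol_equation_sub_le h0 h1 hs z)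
  have hshift := abs_le.1 (abs_binE_succ_stdize_mul_steinSol_sub_le h0 h1 hs z)
  have hindicator := abs_le.1 (abs_binE_succ_stdize_le_sub_le (n := n) h0 h1 z)
  rw [binE_add, binE_sub, binE_const] at hequation
  have hsum : (13 + 2 * steinBound) / binSD (n + 1) p = (8 + steinBound) / binSD (n + 1) p +
      (4 + steinBound) / binSD (n + 1) p + 1 / binSD (n + 1) p := by ring
  simp only [binProbLE, ← stdize_le_iff hs0]
  rw [abs_le]
  constructor <;> linarith

end Probability

theorem normalPDF_mul_sub_le {x y B : ℝ} (hxy : x ≤ y) (hx : -B ≤ x) (hy : y ≤ B) :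
    normalPDF B * (y - x) ≤ normalCDF y - normalCDF x :=
  (convex_Icc x y).mul_sub_le_image_sub_of_le_deriv continuous_normalCDF.continuousOn
    (fun w _ => (hasDerivAt_normalCDF w).differentiableAt.differentiableWithinAt)
    (fun w hw => by
      rw [interior_Icc] at hw
      rw [(hasDerivAt_normalCDF w).deriv]
      exact normalPDF_le_of_abs_le ((abs_le.2 ⟨by linarith [hw.1], by linarith [hw.2]⟩).trans
        (le_abs_self B))) x (Set.left_mem_Icc.2 hxy) y (Set.right_mem_Icc.2 hxy) hxy

/-- Moving `t` by `a` changes the normal approximation by a multiple of `a / binSD n p`, which beats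
the Berry–Esseen error. -/
theorem exists_binProbLE_quantile {p : ℝ} (h0 : 0 < p) (h1 : p < 1) (z : ℝ) :
    ∃ a : ℝ, ∀ᶠ n : ℕ in atTop,
      binProbLE n p (n * p + binSD n p * z - a) ≤ normalCDF z - 1 / binSD n p ∧
      normalCDF z + 1 / binSD n p ≤ binProbLE n p (n * p + binSD n p * z + a) := by
  set C := 13 + 2 * steinBound
  have hC0 : 0 ≤ C := by linarith [one_le_steinBound]
  have hφ := normalPDF_pos (|z| + 1)
  set φ := normalPDF (|z| + 1) with hφ_def
  refine ⟨(C + 1) / φ, ?_⟩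
  filter_upwards [(tendsto_binSD_atTop h0 h1).eventually_ge_atTop ((C + 1) / φ),
    eventually_ne_atTop 0] with n hs hn
  set s := binSD n p
  have hs0 : 0 < s := binSD_pos hn h0 h1
  set η := (C + 1) / φ / s with hη
  have hη0 : 0 ≤ η := by positivity
  have hη1 : η ≤ 1 := (div_le_one hs0).2 hs
  have hsη : s * η = (C + 1) / φ := mul_div_cancel₀ _ hs0.ne'
  have hφη : φ * η = C / s + 1 / s := by
    rw [hη]
    field_simp
  have hz := abs_le.1 (le_refl |z|)
  constructor
  · have hBE := (abs_le.1 (abs_binProbLE_sub_normalCDF_le hn h0 h1 (z - η))).2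
    have hgap := normalPDF_mul_sub_le (x := z - η) (y := z) (B := |z| + 1) (by linarith)
      (by linarith) (by linarith)
    rw [mul_sub, ← add_sub_assoc, hsη] at hBE
    rw [sub_sub_cancel, ← hφ_def, hφη] at hgap
    linarith
  · have hBE := (abs_le.1 (abs_binProbLE_sub_normalCDF_le hn h0 h1 (z + η))).1
    have hgap := normalPDF_mul_sub_le (x := z) (y := z + η) (B := |z| + 1) (by linarith)
      (by linarith) (by linarith)
    rw [mul_add, ← add_assoc, hsη] at hBE
    rw [add_sub_cancel_left, ← hφ_def, hφη] at hgap
    linarith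

/-! ### The weight of a Pauli error -/

section HammingNorm

variable {ι α : Type*} [Fintype ι] [DecidableEq ι] [Fintype α] [DecidableEq α] [Zero α]

theorem card_filter_support_eq (s : Finset ι) :
    #{f : ι → α | ({i | f i ≠ 0} : Finset ι) = s} = (Fintype.card α - 1) ^ #s := by
  have hpi : ({f : ι → α | ({i | f i ≠ 0} : Finset ι) = s} : Finset (ι → α)) =
      Fintype.piFinset fun i => if i ∈ s then univ.erase 0 else {0} := by
    ext f
    simp only [mem_filter, mem_univ, true_and, Fintype.mem_piFinset, Finset.ext_iff]
    refine forall_congr' fun i => ?_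
    by_cases hi : i ∈ s <;> simp [hi]
  rw [hpi, Fintype.card_piFinset]
  simp only [apply_ite card, card_erase_of_mem (mem_univ _), card_univ, card_singleton]
  rw [prod_ite_mem, univ_inter, prod_const]

theorem sum_hammingNorm {R : Type*} [CommSemiring R] (F : ℕ → R) :
    ∑ f : ι → α, F (hammingNorm f) = ∑ w ∈ range (Fintype.card ι + 1),
      ((Fintype.card ι).choose w : R) * ((Fintype.card α - 1 : ℕ) : R) ^ w * F w := by
  have hfiber (s : Finset ι) : ∑ f : ι → α with ({i | f i ≠ 0} : Finset ι) = s,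
      F (hammingNorm f) = ((Fintype.card α - 1 : ℕ) : R) ^ #s * F #s := by
    rw [sum_congr rfl (g := fun _ => F #s) fun f hf => by rw [hammingNorm, (mem_filter.1 hf).2],
      sum_const, card_filter_support_eq, nsmul_eq_mul, Nat.cast_pow]
  rw [← sum_fiberwise univ fun f : ι → α => ({i | f i ≠ 0} : Finset ι),
    sum_congr rfl fun s _ => hfiber s, ← powerset_univ,
    sum_powerset_apply_card fun w => ((Fintype.card α - 1 : ℕ) : R) ^ w * F w, card_univ]
  exact sum_congr rfl fun w _ => by rw [nsmul_eq_mul, mul_assoc]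

end HammingNorm

/-- A Pauli error as the family of its pairs of exponents on the qubits, which identifies
`weight` with the Hamming norm over an alphabet of four letters. -/
def qubitEquiv (n : ℕ) : PVec n ≃ (Fin n → ZMod 2 × ZMod 2) :=
  Equiv.ofBijective (fun u i => (u (xPos i), u (xPos i).rev)) <| by
    rw [Fintype.bijective_iff_injective_and_card]
    refine ⟨fun u v huv => funext fun j => ?_, by simp [pow_mul, ZMod.card]⟩
    by_cases hj : (j : ℕ) < n
    · exact congrArg Prod.fst (congrFun huv ⟨j, hj⟩)
    · have hrev : (j.rev : ℕ) < n := by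
        rw [Fin.val_rev]
        omega
      have hpos : (xPos ⟨j.rev, hrev⟩).rev = j := Fin.rev_rev j
      simpa only [hpos] using congrArg Prod.snd (congrFun huv ⟨j.rev, hrev⟩)

theorem weight_eq_hammingNorm {n : ℕ} (u : PVec n) : weight u = hammingNorm (qubitEquiv n u) := by
  simp [weight, hammingNorm, qubitEquiv, Prod.ext_iff]

theorem sum_weight {R : Type*} [CommSemiring R] (n : ℕ) (F : ℕ → R) :
    ∑ u : PVec n, F (weight u) = ∑ w ∈ range (n + 1), (n.choose w : R) * 3 ^ w * F w := by
  simp only [weight_eq_hammingNorm]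
  rw [(qubitEquiv n).sum_comp fun f => F (hammingNorm f), sum_hammingNorm]
  simp

theorem weight_le {n : ℕ} (u : PVec n) : weight u ≤ n :=
  (card_le_univ _).trans_eq (Fintype.card_fin n)

/-- The probability under `depolarizingLaw n δ` of each single error of weight `w`. -/
def weightProb (n : ℕ) (δ : ℝ) (w : ℕ) : ℝ := (δ / 3) ^ w * (1 - δ) ^ (n - w)

theorem depolarizingLaw_eq_weightProb (n : ℕ) (δ : ℝ) (u : PVec n) :
    depolarizingLaw n δ u = weightProb n δ (weight u) :=
  depolarizingLaw_eq n δ u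

theorem choose_mul_weightProb (n : ℕ) (δ : ℝ) (w : ℕ) :
    (n.choose w : ℝ) * 3 ^ w * weightProb n δ w =
      (n.choose w : ℝ) * δ ^ w * (1 - δ) ^ (n - w) := by
  have : (3 : ℝ) ^ w ≠ 0 := by positivity
  rw [weightProb, div_pow]
  field_simp

theorem sum_depolarizingLaw_mul (n : ℕ) (δ : ℝ) (g : ℕ → ℝ) :
    ∑ u : PVec n, depolarizingLaw n δ u * g (weight u) = binE n δ g := by
  simp only [depolarizingLaw_eq_weightProb]
  rw [sum_weight n fun w => weightProb n δ w * g w, binE]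
  refine sum_congr rfl fun w _ => ?_
  rw [← mul_assoc, choose_mul_weightProb]

theorem depolarizingLaw_nonneg {n : ℕ} {δ : ℝ} (h0 : 0 ≤ δ) (h1 : δ ≤ 1) (u : PVec n) :
    0 ≤ depolarizingLaw n δ u := by
  have : 0 ≤ 1 - δ := by linarith
  rw [depolarizingLaw_eq]
  positivity

theorem sum_depolarizingLaw (n : ℕ) (δ : ℝ) : ∑ u : PVec n, depolarizingLaw n δ u = 1 := by
  simpa [binE_const] using sum_depolarizingLaw_mul n δ fun _ => 1

/-! ### The symplectic group -/

section Symplectic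

open Matrix

variable {n : ℕ}

/-- The symplectic form on `𝔽₂^{2n}`, whose Gram matrix is the reverse diagonal matrix. -/
def sympForm (n : ℕ) : LinearMap.BilinForm (ZMod 2) (PVec n) := Matrix.toBilin' (revDiag (2 * n))

theorem sympForm_apply (x y : PVec n) : sympForm n x y = ∑ i, x i * y i.rev := by
  simp [sympForm, Matrix.toBilin'_apply', revDiag, dotProduct, mulVec]

theorem sympForm_comm (x y : PVec n) : sympForm n x y = sympForm n y x := by
  rw [sympForm_apply, sympForm_apply]
  exact sum_equiv Fin.revPerm (by simp) fun i _ => by simp [mul_comm]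

theorem sympForm_self (x : PVec n) : sympForm n x x = 0 := by
  rw [sympForm_apply]
  refine sum_involution (fun i _ => i.rev) (fun i _ => ?_) (fun i _ _ hfixed => ?_)
    (fun i _ => mem_univ _) fun i _ => Fin.rev_rev i
  · rw [Fin.rev_rev, mul_comm, CharTwo.add_self_eq_zero]
  · have := congrArg Fin.val hfixed
    rw [Fin.val_rev] at this
    omega

theorem exists_sympForm_eq_one {u : PVec n} (hu : u ≠ 0) : ∃ w, sympForm n u w = 1 := by
  obtain ⟨i, hi⟩ := Function.ne_iff.1 hu
  have hi' : u i = 1 := Fin.eq_one_of_ne_zero (u i) hi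
  exact ⟨Pi.single i.rev 1, by simp [sympForm_apply, Pi.single_apply, Fin.rev_inj, hi']⟩

theorem mem_symplecticSet_iff {C : Matrix (Fin (2 * n)) (Fin (2 * n)) (ZMod 2)} :
    C ∈ symplecticSet n ↔ ∀ x y, sympForm n (C *ᵥ x) (C *ᵥ y) = sympForm n x y := by
  have hcomp : (sympForm n).comp (toLin' C) (toLin' C) =
      Matrix.toBilin' (Cᵀ * revDiag (2 * n) * C) := Matrix.toBilin'_comp _ _ _
  change Cᵀ * revDiag (2 * n) * C = revDiag (2 * n) ↔ _
  rw [← Matrix.toBilin'.injective.eq_iff, ← hcomp, LinearMap.ext_iff₂]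
  rfl

theorem one_mem_symplecticSet (n : ℕ) : 1 ∈ symplecticSet n := by
  simp [mem_symplecticSet_iff]

theorem mul_mem_symplecticSet {S T : Matrix (Fin (2 * n)) (Fin (2 * n)) (ZMod 2)}
    (hS : S ∈ symplecticSet n) (hT : T ∈ symplecticSet n) : S * T ∈ symplecticSet n := by
  rw [mem_symplecticSet_iff] at hS hT ⊢
  intro x y
  rw [← mulVec_mulVec, ← mulVec_mulVec, hS, hT]

theorem mulVec_injective_of_mem_symplecticSet
    {C : Matrix (Fin (2 * n)) (Fin (2 * n)) (ZMod 2)} (hC : C ∈ symplecticSet n) :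
    Function.Injective C.mulVec := by
  refine (injective_iff_map_eq_zero C.mulVecLin).2 fun u hu => ?_
  by_contra hne
  obtain ⟨w, hw⟩ := exists_sympForm_eq_one hne
  rw [← mem_symplecticSet_iff.1 hC, ← mulVecLin_apply, hu] at hw
  simp at hw

/-- The matrix of the symplectic transvection `x ↦ x + ⟨a, x⟩ a`. -/
def sympTransvection (a : PVec n) : Matrix (Fin (2 * n)) (Fin (2 * n)) (ZMod 2) :=
  LinearMap.toMatrix' (LinearMap.transvection (sympForm n a) a)

theorem sympTransvection_mulVec (a x : PVec n) :
    sympTransvection a *ᵥ x = x + sympForm n a x • a := by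
  rw [sympTransvection, LinearMap.toMatrix'_mulVec, LinearMap.transvection.apply]

theorem sympTransvection_mem (a : PVec n) : sympTransvection a ∈ symplecticSet n := by
  refine mem_symplecticSet_iff.2 fun x y => ?_
  simp only [sympTransvection_mulVec, map_add, map_smul, LinearMap.add_apply,
    LinearMap.smul_apply, smul_eq_mul, sympForm_self, sympForm_comm x a]
  linear_combination CharTwo.add_self_eq_zero (sympForm n a x * sympForm n a y)

theorem sympTransvection_sub_mulVec {u v : PVec n} (huv : sympForm n u v = 1) :
    sympTransvection (v - u) *ᵥ u = v := by
  rw [sympTransvection_mulVec, map_sub, LinearMap.sub_apply, sympForm_self, sympForm_comm, huv]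
  simp

theorem exists_sympForm_eq_one_and_eq_one {u v : PVec n} (hu : u ≠ 0) (hv : v ≠ 0) :
    ∃ w, sympForm n u w = 1 ∧ sympForm n v w = 1 := by
  obtain ⟨a, ha⟩ := exists_sympForm_eq_one hu
  obtain ⟨b, hb⟩ := exists_sympForm_eq_one hv
  by_cases hva : sympForm n v a = 0
  · by_cases hub : sympForm n u b = 0
    · exact ⟨a + b, by simp [ha, hub], by simp [hva, hb]⟩
    · exact ⟨b, Fin.eq_one_of_ne_zero _ hub, hb⟩
  · exact ⟨a, ha, Fin.eq_one_of_ne_zero _ hva⟩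

theorem exists_mem_symplecticSet_mulVec_eq {u v : PVec n} (hu : u ≠ 0) (hv : v ≠ 0) :
    ∃ T ∈ symplecticSet n, T *ᵥ u = v := by
  obtain ⟨w, huw, hvw⟩ := exists_sympForm_eq_one_and_eq_one hu hv
  refine ⟨sympTransvection (v - w) * sympTransvection (w - u),
    mul_mem_symplecticSet (sympTransvection_mem _) (sympTransvection_mem _), ?_⟩
  rw [← mulVec_mulVec, sympTransvection_sub_mulVec huw,
    sympTransvection_sub_mulVec (sympForm_comm v w ▸ hvw)]

/-- The symplectic group as a finite set. -/
def symplecticFinset (n : ℕ) : Finset (Matrix (Fin (2 * n)) (Fin (2 * n)) (ZMod 2)) :=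
  (symplecticSet n).toFinite.toFinset

theorem mem_symplecticFinset {C : Matrix (Fin (2 * n)) (Fin (2 * n)) (ZMod 2)} :
    C ∈ symplecticFinset n ↔ C ∈ symplecticSet n :=
  Set.Finite.mem_toFinset _

theorem symplecticFinset_nonempty (n : ℕ) : (symplecticFinset n).Nonempty :=
  ⟨1, mem_symplecticFinset.2 (one_mem_symplecticSet n)⟩

theorem card_symplecticFinset_mulVec_eq_le (w : PVec n) {y z : PVec n} (hy : y ≠ 0) (hz : z ≠ 0) :
    #{C ∈ symplecticFinset n | C *ᵥ w = y} ≤ #{C ∈ symplecticFinset n | C *ᵥ w = z} := by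
  obtain ⟨T, hT, hTy⟩ := exists_mem_symplecticSet_mulVec_eq hy hz
  have hTunit := mulVec_injective_iff_isUnit.1 (mulVec_injective_of_mem_symplecticSet hT)
  refine card_le_card_of_injOn (T * ·) (fun C hC => ?_) hTunit.mul_right_injective.injOn
  rw [mem_coe, mem_filter, mem_symplecticFinset] at hC ⊢
  exact ⟨mul_mem_symplecticSet hT hC.1, by rw [← mulVec_mulVec, hC.2, hTy]⟩

theorem card_symplecticFinset_mulVec_mem {w : PVec n} (hw : w ≠ 0) {s : Finset (PVec n)}
    (hs : 0 ∉ s) : #{C ∈ symplecticFinset n | C *ᵥ w ∈ s} =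
      #s * #{C ∈ symplecticFinset n | C *ᵥ w = w} := by
  have hmaps : Set.MapsTo (· *ᵥ w) (SetLike.coe {C ∈ symplecticFinset n | C *ᵥ w ∈ s}) s :=
    fun C hC => (mem_filter.1 hC).2
  rw [card_eq_sum_card_fiberwise hmaps]
  refine sum_const_nat fun z hz => ?_
  have hz0 : z ≠ 0 := ne_of_mem_of_not_mem hz hs
  have hfiber : {C ∈ symplecticFinset n | C *ᵥ w ∈ s ∧ C *ᵥ w = z} =
      {C ∈ symplecticFinset n | C *ᵥ w = z} :=
    filter_congr fun C _ => and_iff_right_of_imp fun h => h ▸ hz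
  rw [filter_filter, hfiber]
  exact le_antisymm (card_symplecticFinset_mulVec_eq_le w hz0 hw)
    (card_symplecticFinset_mulVec_eq_le w hw hz0)

theorem card_filter_forall_mem_eq_zero {ι α : Type*} [Fintype ι] [DecidableEq ι] [Fintype α]
    [DecidableEq α] [Zero α] (s : Finset ι) :
    #{z : ι → α | ∀ i ∈ s, z i = 0} = Fintype.card α ^ (Fintype.card ι - #s) := by
  have hpi : ({z | ∀ i ∈ s, z i = 0} : Finset (ι → α)) =
      Fintype.piFinset fun i => if i ∈ sᶜ then univ else {0} := by
    ext z
    simp only [mem_filter, mem_univ, true_and, Fintype.mem_piFinset, mem_compl]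
    refine forall_congr' fun i => ?_
    by_cases hi : i ∈ s <;> simp [hi]
  rw [hpi, Fintype.card_piFinset]
  simp only [apply_ite card, card_univ, card_singleton]
  rw [prod_ite_mem, univ_inter, prod_const, card_compl]

theorem card_filter_castLE_eq_zero {α : Type*} [Fintype α] [DecidableEq α] [Zero α] {m N : ℕ}
    (hm : m ≤ N) :
    #{z : Fin N → α | ∀ i : Fin m, z (Fin.castLE hm i) = 0} = Fintype.card α ^ (N - m) := by
  simpa using card_filter_forall_mem_eq_zero (α := α) (univ.map (Fin.castLEEmb hm))

theorem card_syndrome_eq_zero_le {m : ℕ} (hm : m ≤ n) {w : PVec n} (hw : w ≠ 0) :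
    2 ^ m * #{C ∈ symplecticFinset n | syndrome hm C w = 0} ≤ #(symplecticFinset n) := by
  have hm' : m ≤ 2 * n := hm.trans (Nat.le_mul_of_pos_left n two_pos)
  set kernel : Finset (PVec n) := {z | ∀ i : Fin m, z (Fin.castLE hm' i) = 0} with hkernel
  have hcard_kernel : #kernel = 2 ^ (2 * n - m) := by
    rw [hkernel, card_filter_castLE_eq_zero, ZMod.card]
  have hne (C) (hC : C ∈ symplecticFinset n) : C *ᵥ w ≠ 0 := fun h =>
    hw (mulVec_injective_of_mem_symplecticSet (mem_symplecticFinset.1 hC)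
      (h.trans (mulVec_zero C).symm))
  have hall : {C ∈ symplecticFinset n | C *ᵥ w ∈ univ.erase 0} = symplecticFinset n :=
    filter_true_of_mem fun C hC => mem_erase.2 ⟨hne C hC, mem_univ _⟩
  have hsyndrome : {C ∈ symplecticFinset n | syndrome hm C w = 0} =
      {C ∈ symplecticFinset n | C *ᵥ w ∈ kernel.erase 0} :=
    filter_congr fun C hC => by simp [hkernel, hne C hC, funext_iff, syndrome]
  have hcard : 2 ^ m * #(kernel.erase 0) ≤ #(univ.erase (0 : PVec n)) := by
    rw [card_erase_of_mem (mem_univ _), card_erase_of_mem (by simp [hkernel]), hcard_kernel,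
      Nat.mul_sub, ← pow_add, Nat.add_sub_of_le hm', card_univ, Fintype.card_fun, ZMod.card,
      Fintype.card_fin]
    exact Nat.sub_le_sub_left (by simpa using Nat.one_le_two_pow) _
  calc 2 ^ m * #{C ∈ symplecticFinset n | syndrome hm C w = 0}
      = 2 ^ m * #(kernel.erase 0) * #{C ∈ symplecticFinset n | C *ᵥ w = w} := by
        rw [hsyndrome, card_symplecticFinset_mulVec_mem hw (notMem_erase _ _), mul_assoc]
    _ ≤ #(univ.erase (0 : PVec n)) * #{C ∈ symplecticFinset n | C *ᵥ w = w} :=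
        Nat.mul_le_mul_right _ hcard
    _ = #(symplecticFinset n) := by
        rw [← card_symplecticFinset_mulVec_mem hw (notMem_erase _ _), hall]

end Symplectic

/-! ### Random coding and converse bounds -/

section Coding

variable {n m : ℕ} (hm : m ≤ n) {p : PVec n → ℝ}

theorem syndrome_sub (C : Matrix (Fin (2 * n)) (Fin (2 * n)) (ZMod 2)) (u v : PVec n) :
    syndrome hm C (u - v) = syndrome hm C u - syndrome hm C v := by
  funext i
  simp [syndrome, Matrix.mulVec_sub]

section RandomCoding

variable {β : Type*} [LinearOrder β] (f : PVec n → β)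

theorem exists_decoder_minimizing (C : Matrix (Fin (2 * n)) (Fin (2 * n)) (ZMod 2)) :
    ∃ D : (Fin m → ZMod 2) → PVec n, ∀ u,
      syndrome hm C (D (syndrome hm C u)) = syndrome hm C u ∧ f (D (syndrome hm C u)) ≤ f u := by
  have hmin (s : Fin m → ZMod 2) :
      ∃ v : PVec n, ∀ u, syndrome hm C u = s → syndrome hm C v = s ∧ f v ≤ f u := by
    by_cases hs : ∃ u, syndrome hm C u = s
    · obtain ⟨u, hu⟩ := hs
      obtain ⟨v, hv, hle⟩ := exists_min_image {u | syndrome hm C u = s} f ⟨u, by simpa⟩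
      exact ⟨v, fun u hu => ⟨(mem_filter.1 hv).2, hle u (by simpa)⟩⟩
    · exact ⟨0, fun u hu => absurd ⟨u, hu⟩ hs⟩
  choose D hD using hmin
  exact ⟨D, fun u => hD _ u rfl⟩

theorem exists_guessErrorProb_le_sum_min_card (hp : ∀ u, 0 ≤ p u)
    (C : Matrix (Fin (2 * n)) (Fin (2 * n)) (ZMod 2)) :
    ∃ D, guessErrorProb hm p C D ≤ ∑ u, p u *
      min 1 (#{v | (v ≠ u ∧ f v ≤ f u) ∧ syndrome hm C (v - u) = 0} : ℝ) := by
  obtain ⟨D, hD⟩ := exists_decoder_minimizing hm f C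
  refine ⟨D, ?_⟩
  rw [guessErrorProb, sum_filter]
  refine sum_le_sum fun u _ => ?_
  split_ifs with hu
  · have hcompetitor : D (syndrome hm C u) ∈
        ({v | (v ≠ u ∧ f v ≤ f u) ∧ syndrome hm C (v - u) = 0} : Finset (PVec n)) := by
      simp [hu, hD u, syndrome_sub]
    refine le_mul_of_one_le_right (hp u) (le_min le_rfl ?_)
    exact_mod_cast card_pos.2 ⟨_, hcompetitor⟩
  · exact mul_nonneg (hp u) (by positivity)

theorem sum_symplecticFinset_min_card_le (s : Finset (PVec n)) {u : PVec n} (hu : u ∉ s) :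
    ∑ C ∈ symplecticFinset n, min 1 (#{v ∈ s | syndrome hm C (v - u) = 0} : ℝ) ≤
      #(symplecticFinset n) * min 1 ((#s : ℝ) / 2 ^ m) := by
  have hcollision (v) (hv : v ∈ s) :
      (#{C ∈ symplecticFinset n | syndrome hm C (v - u) = 0} : ℝ) ≤
        #(symplecticFinset n) / 2 ^ m := by
    rw [le_div_iff₀' (by positivity)]
    exact_mod_cast card_syndrome_eq_zero_le hm (sub_ne_zero.2 (ne_of_mem_of_not_mem hv hu))
  rw [mul_min_of_nonneg _ _ (Nat.cast_nonneg _), mul_one]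
  refine le_min ?_ ?_
  · exact (sum_le_card_nsmul _ _ 1 fun C _ => min_le_left _ _).trans_eq (by simp)
  · calc ∑ C ∈ symplecticFinset n, min 1 (#{v ∈ s | syndrome hm C (v - u) = 0} : ℝ)
        ≤ ∑ C ∈ symplecticFinset n, (#{v ∈ s | syndrome hm C (v - u) = 0} : ℝ) :=
          sum_le_sum fun C _ => min_le_right _ _
      _ = ∑ v ∈ s, (#{C ∈ symplecticFinset n | syndrome hm C (v - u) = 0} : ℝ) := by
          exact_mod_cast sum_card_bipartiteAbove_eq_sum_card_bipartiteBelow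
            fun C v => syndrome hm C (v - u) = 0
      _ ≤ ∑ v ∈ s, (#(symplecticFinset n) : ℝ) / 2 ^ m := sum_le_sum hcollision
      _ = #(symplecticFinset n) * ((#s : ℝ) / 2 ^ m) := by
          rw [sum_const, nsmul_eq_mul]
          ring

theorem exists_guessErrorProb_le_sum_min (hp : ∀ u, 0 ≤ p u) :
    ∃ C ∈ symplecticSet n, ∃ D, guessErrorProb hm p C D ≤
      ∑ u, p u * min 1 ((#{v | v ≠ u ∧ f v ≤ f u} : ℝ) / 2 ^ m) := by
  choose D hD using exists_guessErrorProb_le_sum_min_card hm f hp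
  have haverage : ∑ C ∈ symplecticFinset n, guessErrorProb hm p C (D C) ≤
      ∑ _C ∈ symplecticFinset n, ∑ u, p u * min 1 ((#{v | v ≠ u ∧ f v ≤ f u} : ℝ) / 2 ^ m) := by
    refine (sum_le_sum fun C _ => hD C).trans ?_
    rw [sum_comm, sum_const, nsmul_eq_mul, mul_sum]
    refine sum_le_sum fun u _ => ?_
    rw [← mul_sum, mul_left_comm]
    refine mul_le_mul_of_nonneg_left ?_ (hp u)
    simpa only [filter_filter] using
      sum_symplecticFinset_min_card_le hm {v | v ≠ u ∧ f v ≤ f u} (u := u) (by simp)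
  obtain ⟨C, hC, hle⟩ := exists_le_of_sum_le (symplecticFinset_nonempty n) haverage
  exact ⟨C, mem_symplecticFinset.1 hC, D C, hle⟩

end RandomCoding

theorem card_guessed_le (C : Matrix (Fin (2 * n)) (Fin (2 * n)) (ZMod 2))
    (D : (Fin m → ZMod 2) → PVec n) : #{u | D (syndrome hm C u) = u} ≤ 2 ^ m :=
  calc #{u | D (syndrome hm C u) = u} ≤ #(univ.image D) := card_le_card fun u hu =>
        mem_image.2 ⟨_, mem_univ _, (mem_filter.1 hu).2⟩
    _ ≤ #(univ : Finset (Fin m → ZMod 2)) := card_image_le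
    _ = 2 ^ m := by simp

theorem one_sub_guessErrorProb_le (hp : ∀ u, 0 ≤ p u) (hsum : ∑ u, p u = 1)
    (s : Finset (PVec n)) {B : ℝ} (hB : 0 ≤ B) (hpB : ∀ u ∉ s, p u ≤ B)
    (C : Matrix (Fin (2 * n)) (Fin (2 * n)) (ZMod 2)) (D : (Fin m → ZMod 2) → PVec n) :
    1 - guessErrorProb hm p C D ≤ ∑ u ∈ s, p u + 2 ^ m * B := by
  set guessed : Finset (PVec n) := {u | D (syndrome hm C u) = u} with hguessed
  have hcorrect : 1 - guessErrorProb hm p C D = ∑ u ∈ guessed, p u := by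
    rw [← hsum, guessErrorProb, hguessed, ← sum_filter_add_sum_filter_not univ
      (fun u => D (syndrome hm C u) = u) p, add_sub_cancel_right]
  calc 1 - guessErrorProb hm p C D
      = ∑ u ∈ guessed with u ∈ s, p u + ∑ u ∈ guessed with u ∉ s, p u := by
        rw [hcorrect, sum_filter_add_sum_filter_not]
    _ ≤ ∑ u ∈ s, p u + ∑ u ∈ guessed with u ∉ s, B := by
        refine add_le_add (sum_le_sum_of_subset_of_nonneg (fun u hu => (mem_filter.1 hu).2)
          fun u _ _ => hp u) (sum_le_sum fun u hu => hpB u (mem_filter.1 hu).2)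
    _ ≤ ∑ u ∈ s, p u + 2 ^ m * B := by
        rw [sum_const, nsmul_eq_mul]
        have hcard := (card_filter_le guessed (· ∉ s)).trans (card_guessed_le hm C D)
        gcongr
        exact_mod_cast hcard

end Coding

/-! ### Lists in decreasing order of probability -/

section SortedOrder

variable {n : ℕ} {p : PVec n → ℝ} {o : Fin (2 ^ (2 * n)) ≃ PVec n}

theorem IsSortedOrder.apply_le_of_card_le (ho : IsSortedOrder p o) {x : ℝ}
    {j : Fin (2 ^ (2 * n))} (hcard : #{u | x < p u} ≤ j) : p (o j) ≤ x := by
  by_contra! hx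
  have hsub : (Iic j).map o.toEmbedding ⊆ ({u | x < p u} : Finset (PVec n)) := fun u hu => by
    obtain ⟨l, hl, rfl⟩ := Finset.mem_map.1 hu
    exact mem_filter.2 ⟨mem_univ _, hx.trans_le (ho (mem_Iic.1 hl))⟩
  have := card_le_card hsub
  rw [card_map, Fin.card_Iic] at this
  lia

theorem IsSortedOrder.le_apply_of_lt_card (ho : IsSortedOrder p o) {x : ℝ}
    {j : Fin (2 ^ (2 * n))} (hcard : (j : ℕ) < #{u | x ≤ p u}) : x ≤ p (o j) := by
  by_contra! hx
  have hsub : ({u | x ≤ p u} : Finset (PVec n)) ⊆ (Iio j).map o.toEmbedding := fun u hu => by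
    refine Finset.mem_map.2 ⟨o.symm u, mem_Iio.2 ?_, o.apply_symm_apply u⟩
    by_contra! hj
    have := ho hj
    simp only [o.apply_symm_apply] at this
    exact (this.trans_lt hx).not_ge (mem_filter.1 hu).2
  have := card_le_card hsub
  rw [card_map, Fin.card_Iio] at this
  lia

/-- The probability of entry number `j` of the list `o`, counted from `0`, and `0` past its end. -/
def listProb (p : PVec n → ℝ) (o : Fin (2 ^ (2 * n)) ≃ PVec n) : ℕ → ℝ :=
  Function.extend Fin.val (p ∘ o) 0

theorem listProb_val (p : PVec n → ℝ) (o : Fin (2 ^ (2 * n)) ≃ PVec n) (j : Fin (2 ^ (2 * n))) :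
    listProb p o j = p (o j) :=
  Fin.val_injective.extend_apply _ _ _

theorem sum_position_le (p : PVec n → ℝ) (o : Fin (2 ^ (2 * n)) ≃ PVec n) (M : ℕ) (g : ℕ → ℝ) :
    ∑ u with position o u ≤ M, p u * g (position o u) =
      ∑ j ∈ range M, listProb p o j * g (j + 1) := by
  refine sum_of_injOn (fun u => (o.symm u : ℕ))
    (Fin.val_injective.comp o.symm.injective).injOn (fun u hu => ?_) (fun j hj hju => ?_)
    fun u _ => by rw [listProb_val, o.apply_symm_apply, position]
  · simpa [position, Nat.succ_le_iff] using hu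
  · rw [listProb, Function.extend_apply', Pi.zero_apply, zero_mul]
    rintro ⟨k, rfl⟩
    exact hju ⟨o k, by simpa [position, Nat.succ_le_iff] using hj, by simp⟩

theorem sum_position_le_sub_one (p : PVec n → ℝ) (o : Fin (2 ^ (2 * n)) ≃ PVec n) (M : ℕ) :
    ∑ u with position o u ≤ M, p u * (position o u - 1 : ℝ) =
      (∑ j ∈ range M, listProb p o j * (((j + 1 : ℕ) : ℝ) ^ 2 - (j : ℝ) ^ 2) -
        ∑ u with position o u ≤ M, p u) / 2 := by
  have hcount := sum_position_le p o M fun _ => 1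
  simp only [mul_one] at hcount
  rw [sum_position_le p o M fun k => (k : ℝ) - 1, hcount, ← sum_sub_distrib, sum_div]
  refine sum_congr rfl fun j _ => ?_
  push_cast
  ring

theorem errorConverse_eq_one_sub (hsum : ∑ u, p u = 1) (o : Fin (2 ^ (2 * n)) ≃ PVec n) (m : ℕ) :
    errorConverse p o m = 1 - ∑ u with position o u ≤ 2 ^ m, p u := by
  rw [errorConverse, ← hsum,
    ← sum_filter_add_sum_filter_not univ (fun u => position o u ≤ 2 ^ m) p, add_sub_cancel_left]
  simp only [not_le]

theorem errorAchievability_eq_add (p : PVec n → ℝ) (o : Fin (2 ^ (2 * n)) ≃ PVec n) (m : ℕ) :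
    errorAchievability p o m = errorConverse p o m +
      (∑ u with position o u ≤ 2 ^ m, p u * (position o u - 1 : ℝ)) / 2 ^ m := by
  simp only [errorAchievability, errorConverse, sum_div, mul_div_assoc]

end SortedOrder

section Blocks

variable {q Q G : ℕ → ℝ}

theorem sum_Ico_mul_sub_of_eq {a b : ℕ} (hab : a ≤ b) {x : ℝ}
    (hq : ∀ j, a ≤ j → j < b → q j = x) :
    ∑ j ∈ Ico a b, q j * (G (j + 1) - G j) = x * (G b - G a) := by
  rw [← sum_Ico_sub G hab, mul_sum]
  exact sum_congr rfl fun j hj => by rw [hq j (mem_Ico.1 hj).1 (mem_Ico.1 hj).2]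

theorem sum_range_mul_sub_of_blocks {c : ℕ → ℕ} (hc0 : c 0 = 0) (hc : Monotone c) {L : ℕ}
    (hq : ∀ i < L, ∀ j, c i ≤ j → j < c (i + 1) → q j = Q i) :
    ∑ j ∈ range (c L), q j * (G (j + 1) - G j) =
      ∑ i ∈ range L, Q i * (G (c (i + 1)) - G (c i)) := by
  induction L with
  | zero => simp [hc0]
  | succ L ih =>
    rw [sum_range_succ, ← ih fun i hi => hq i (hi.trans (Nat.lt_succ_self L)),
      ← sum_Ico_mul_sub_of_eq (hc (Nat.le_succ L)) (hq L (Nat.lt_succ_self L)),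
      sum_range_add_sum_Ico _ (hc (Nat.le_succ L))]

theorem sum_range_mul_sub_add_mul_sub (Q A : ℕ → ℝ) (hA : A 0 = 0) (L : ℕ) (B : ℝ) :
    ∑ i ∈ range L, Q i * (A (i + 1) - A i) + Q L * (B - A L) =
      Q L * B + ∑ i ∈ range L, (Q i - Q (i + 1)) * A (i + 1) := by
  induction L generalizing B with
  | zero => simp [hA]
  | succ L ih =>
    rw [sum_range_succ, sum_range_succ, ih (A (L + 1))]
    ring

end Blocks

section Weights

variable {n : ℕ} {δ : ℝ}

/-- The number of vectors of weight less than `i`. -/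
def cumCount (n i : ℕ) : ℕ := ∑ j ∈ range i, n.choose j * 3 ^ j

theorem cumCount_zero (n : ℕ) : cumCount n 0 = 0 :=
  sum_range_zero _

theorem cumCount_succ (n i : ℕ) : cumCount n (i + 1) = cumCount n i + n.choose i * 3 ^ i :=
  sum_range_succ _ _

theorem cumCount_mono (n : ℕ) : Monotone (cumCount n) :=
  monotone_nat_of_le_succ fun i => cumCount_succ n i ▸ Nat.le_add_right _ _

theorem card_weight_lt (n i : ℕ) : #{u : PVec n | weight u < i} = cumCount n i := by
  rw [card_filter, sum_weight n fun w => if w < i then 1 else 0, cumCount]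
  simp only [mul_ite, mul_one, mul_zero, Nat.cast_id]
  rw [← sum_filter]
  refine sum_subset (fun w hw => mem_range.2 (mem_filter.1 hw).2) fun w hw hw' => ?_
  have hnw : n < w := by
    by_contra! hwn
    exact hw' (mem_filter.2 ⟨mem_range.2 (Nat.lt_succ_of_le hwn), mem_range.1 hw⟩)
  rw [Nat.choose_eq_zero_of_lt hnw, zero_mul]

theorem cumCount_le (n i : ℕ) : cumCount n i ≤ 2 ^ (2 * n) := by
  rw [← card_weight_lt]
  exact (card_le_univ _).trans_eq (by simp)

theorem weightProb_antitone (h0 : 0 ≤ δ) (h1 : δ ≤ 3 / 4) {i j : ℕ} (hij : i ≤ j) (hj : j ≤ n) :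
    weightProb n δ j ≤ weightProb n δ i := by
  have hratio : δ / 3 ≤ 1 - δ := by linarith
  have hcompl : 0 ≤ 1 - δ := by linarith
  calc weightProb n δ j = (δ / 3) ^ i * ((δ / 3) ^ (j - i) * (1 - δ) ^ (n - j)) := by
        rw [weightProb, ← mul_assoc, ← pow_add, Nat.add_sub_of_le hij]
    _ ≤ (δ / 3) ^ i * ((1 - δ) ^ (j - i) * (1 - δ) ^ (n - j)) := by gcongr
    _ = weightProb n δ i := by
        rw [weightProb, ← pow_add]
        congr 2
        lia

theorem IsSortedOrder.listProb_eq (h0 : 0 ≤ δ) (h1 : δ ≤ 3 / 4)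
    {o : Fin (2 ^ (2 * n)) ≃ PVec n} (ho : IsSortedOrder (depolarizingLaw n δ) o) {i j : ℕ}
    (hi : i ≤ n) (hij : cumCount n i ≤ j) (hji : j < cumCount n (i + 1)) :
    listProb (depolarizingLaw n δ) o j = weightProb n δ i := by
  lift j to Fin (2 ^ (2 * n)) using hji.trans_le (cumCount_le n _)
  rw [listProb_val]
  refine le_antisymm (ho.apply_le_of_card_le ?_) (ho.le_apply_of_lt_card ?_)
  · refine le_trans ?_ ((card_weight_lt n i).trans_le hij)
    refine card_le_card (monotone_filter_right _ fun u _ hu => ?_)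
    rw [depolarizingLaw_eq_weightProb] at hu
    by_contra! hweight
    exact hu.not_ge (weightProb_antitone h0 h1 hweight (weight_le u))
  · refine (hji.trans_eq (card_weight_lt n (i + 1)).symm).trans_le ?_
    refine card_le_card (monotone_filter_right _ fun u _ hu => ?_)
    rw [depolarizingLaw_eq_weightProb]
    exact weightProb_antitone h0 h1 (Nat.lt_succ_iff.1 hu) hi

theorem IsSortedOrder.sum_range_listProb_mul_sub (h0 : 0 ≤ δ) (h1 : δ ≤ 3 / 4)
    {o : Fin (2 ^ (2 * n)) ≃ PVec n} (ho : IsSortedOrder (depolarizingLaw n δ) o) (G : ℕ → ℝ)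
    {L M : ℕ} (hL : L ≤ n) (hLM : cumCount n L ≤ M) (hML : M ≤ cumCount n (L + 1)) :
    ∑ j ∈ range M, listProb (depolarizingLaw n δ) o j * (G (j + 1) - G j) =
      ∑ i ∈ range L, weightProb n δ i * (G (cumCount n (i + 1)) - G (cumCount n i)) +
        weightProb n δ L * (G M - G (cumCount n L)) := by
  rw [← sum_range_add_sum_Ico _ hLM,
    sum_range_mul_sub_of_blocks (cumCount_zero n) (cumCount_mono n) fun i hi j =>
      ho.listProb_eq h0 h1 (hi.le.trans hL),
    sum_Ico_mul_sub_of_eq hLM fun j hLj hjM => ho.listProb_eq h0 h1 hL hLj (hjM.trans_le hML)]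

end Weights

/-! ### The interpolated binomial distribution function -/

section BinCDF

theorem binE_reflect (n : ℕ) (p : ℝ) (g : ℕ → ℝ) :
    binE n (1 - p) g = binE n p fun k => g (n - k) := by
  rw [binE, ← sum_range_reflect, binE]
  refine sum_congr rfl fun k hk => ?_
  have hkn : k ≤ n := mem_range_succ_iff.1 hk
  rw [Nat.add_sub_cancel, Nat.choose_symm hkn, Nat.sub_sub_self hkn, sub_sub_cancel]
  ring

variable (N : ℕ) (p : ℝ)

theorem binCDFInt_eq_binE (i : ℤ) :
    binCDFInt N p i = binE N p fun k => if (k : ℤ) ≤ i then 1 else 0 := by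
  simp only [binCDFInt, binE, mul_ite, mul_one, mul_zero]
  rw [← sum_filter]
  refine (sum_subset (fun k hk => ?_) fun k hk hk' => ?_).symm
  · have hki := (mem_filter.1 hk).2
    rw [mem_range]
    lia
  · have hNk : N < k := by
      rw [mem_filter, mem_range] at hk'
      rw [mem_range] at hk
      lia
    rw [Nat.choose_eq_zero_of_lt hNk, Nat.cast_zero, zero_mul, zero_mul]

theorem binCDFInt_natCast_add_one (i : ℕ) :
    binCDFInt N p (i + 1) = binCDFInt N p i +
      (N.choose (i + 1) : ℝ) * p ^ (i + 1) * (1 - p) ^ (N - (i + 1)) :=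
  sum_range_succ _ _

theorem binCDFInt_neg_one : binCDFInt N p (-1) = 0 := by
  simp [binCDFInt]

theorem binCDFInt_self : binCDFInt N p N = 1 := by
  have hsum := binE_const N p 1
  simp only [binE, mul_one] at hsum
  exact hsum

theorem binCDFInt_reflect (i : ℤ) : binCDFInt N (1 - p) (N - 1 - i) = 1 - binCDFInt N p i := by
  rw [binCDFInt_eq_binE, binE_reflect, binCDFInt_eq_binE, eq_sub_iff_add_eq, ← binE_add]
  refine Eq.trans (sum_congr rfl fun k hk => ?_) (binE_const N p 1)
  have hkN : k ≤ N := mem_range_succ_iff.1 hk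
  congr 1
  beta_reduce
  split_ifs <;> first | lia | norm_num

theorem binCDF_intCast (i : ℤ) : binCDF N p i = binCDFInt N p i := by
  simp [binCDF]

theorem binCDF_intCast_add (i : ℤ) {t : ℝ} (ht0 : 0 ≤ t) (ht1 : t ≤ 1) :
    binCDF N p (i + t) = binCDFInt N p i + t * (binCDFInt N p (i + 1) - binCDFInt N p i) := by
  rcases ht1.eq_or_lt with rfl | ht1
  · have := binCDF_intCast N p (i + 1)
    push_cast at this
    rw [this]
    ring
  · have hfract : Int.fract t = t := Int.fract_eq_self.2 ⟨ht0, ht1⟩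
    rw [binCDF, Int.floor_intCast_add, Int.fract_intCast_add, hfract,
      Int.floor_eq_zero_iff.2 ⟨ht0, ht1⟩, add_zero]

theorem binCDF_reflect (x : ℝ) : binCDF N (1 - p) (N - 1 - x) = 1 - binCDF N p x := by
  have hx : (N : ℝ) - 1 - x = ((N - 1 - (⌊x⌋ + 1) : ℤ) : ℝ) + (1 - Int.fract x) := by
    push_cast
    linarith [Int.floor_add_fract x]
  rw [hx, binCDF_intCast_add _ _ _ (by linarith [Int.fract_lt_one x])
    (by linarith [Int.fract_nonneg x]), sub_add_eq_sub_sub, sub_add_cancel,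
    ← sub_add_eq_sub_sub, binCDFInt_reflect, binCDFInt_reflect, binCDF]
  ring

variable {N p}

theorem exists_binCDF_eq {k : ℕ} {y : ℝ} (hy0 : 0 ≤ y) (hyk : y ≤ binCDFInt N p (k - 1)) :
    ∃ x ∈ Set.Icc (-1 : ℝ) (k - 1), binCDF N p x = y := by
  induction k with
  | zero =>
    have hzero : y = 0 := by
      rw [Nat.cast_zero, zero_sub, binCDFInt_neg_one] at hyk
      exact le_antisymm hyk hy0
    have := binCDF_intCast N p (-1)
    rw [binCDFInt_neg_one] at this
    exact ⟨-1, by simp, by simpa [hzero] using this⟩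
  | succ k ih =>
    push_cast at hyk ⊢
    rcases le_or_gt y (binCDFInt N p (k - 1)) with hle | hlt
    · obtain ⟨x, ⟨hx1, hxk⟩, hx⟩ := ih hle
      exact ⟨x, ⟨hx1, by linarith⟩, hx⟩
    · rw [add_sub_right_comm] at hyk
      have hgap : 0 < binCDFInt N p (k - 1 + 1) - binCDFInt N p (k - 1) := by linarith
      set t := (y - binCDFInt N p (k - 1)) / (binCDFInt N p (k - 1 + 1) - binCDFInt N p (k - 1))
        with ht
      have ht0 : 0 ≤ t := div_nonneg (by linarith) hgap.le
      have ht1 : t ≤ 1 := (div_le_one hgap).2 (by linarith)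
      refine ⟨((k - 1 : ℤ) : ℝ) + t, ⟨?_, ?_⟩, ?_⟩
      · push_cast
        linarith [(Nat.cast_nonneg k : (0 : ℝ) ≤ k)]
      · push_cast
        linarith
      · rw [binCDF_intCast_add _ _ _ ht0 ht1, ht, div_mul_cancel₀ _ hgap.ne', add_sub_cancel]

variable (N p) in
theorem surjOn_binCDF : Set.SurjOn (binCDF N p) (Set.Icc (-1) N) (Set.Icc 0 1) := by
  rintro y ⟨hy0, hy1⟩
  have hself : binCDFInt N p ((N + 1 : ℕ) - 1) = 1 := by
    rw [Nat.cast_succ, add_sub_cancel_right, binCDFInt_self]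
  obtain ⟨x, hx, hxy⟩ := exists_binCDF_eq hy0 (hy1.trans_eq hself.symm)
  rw [Nat.cast_succ, add_sub_cancel_right] at hx
  exact ⟨x, hx, hxy⟩

theorem binCDFInt_three_quarters (n i : ℕ) :
    binCDFInt n (3 / 4) i = cumCount n (i + 1) / 4 ^ n := by
  rw [eq_div_iff (by positivity), cumCount]
  push_cast
  rw [binCDFInt, sum_mul]
  refine sum_congr rfl fun j _ => ?_
  rcases le_or_gt j n with hj | hj
  · rw [show (1 : ℝ) - 3 / 4 = 1 / 4 by norm_num, div_pow, div_pow, one_pow,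
      ← Nat.add_sub_of_le hj, pow_add, Nat.add_sub_cancel_left]
    field_simp
  · rw [Nat.choose_eq_zero_of_lt hj]
    simp

theorem binCDF_three_quarters {n L : ℕ} {x : ℝ} (hx : ⌊x⌋ = L) :
    binCDF n (3 / 4) x =
      (cumCount n (L + 1) + Int.fract x * (n.choose (L + 1) * 3 ^ (L + 1))) / 4 ^ n := by
  have hsucc : (L : ℤ) + 1 = (L + 1 : ℕ) := (Nat.cast_succ L).symm
  rw [binCDF, hx, hsucc, binCDFInt_three_quarters, binCDFInt_three_quarters,
    cumCount_succ n (L + 1)]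
  push_cast
  field_simp
  ring

theorem zero_le_of_le_binCDF_three_quarters {n : ℕ} {x : ℝ} (hx : -1 ≤ x)
    (hle : 1 / 4 ^ n ≤ binCDF n (3 / 4) x) : 0 ≤ x := by
  by_contra! hneg
  have hfloor : ⌊x⌋ = -1 := Int.floor_eq_iff.2 ⟨by exact_mod_cast hx, by simpa using hneg⟩
  have hzero : binCDFInt n (3 / 4) 0 = 1 / 4 ^ n := by
    simpa [cumCount] using binCDFInt_three_quarters n 0
  rw [binCDF, hfloor, binCDFInt_neg_one, neg_add_cancel, hzero, zero_add, sub_zero] at hle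
  have hpos : (0 : ℝ) < 1 / 4 ^ n := by positivity
  nlinarith [Int.fract_lt_one x]

theorem exists_floor_eq_of_binCDF_three_quarters_eq {n M : ℕ} (hM0 : 1 ≤ M) (hMn : M < 4 ^ n)
    {ℓ : ℝ} (hmem : ℓ ∈ Set.Icc (-1 : ℝ) n) (hℓ : binCDF n (3 / 4) ℓ = M / 4 ^ n) :
    ∃ L : ℕ, ⌊ℓ⌋ = L ∧ L < n ∧
      (M : ℝ) = cumCount n (L + 1) + Int.fract ℓ * (n.choose (L + 1) * 3 ^ (L + 1)) := by
  have hpow : (0 : ℝ) < 4 ^ n := by positivity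
  have hℓ0 : 0 ≤ ℓ := zero_le_of_le_binCDF_three_quarters hmem.1 <| by
    rw [hℓ]
    gcongr
    exact_mod_cast hM0
  have hℓn : ℓ ≠ n := fun h => by
    have hone := binCDF_intCast n (3 / 4) n
    rw [binCDFInt_self, Int.cast_natCast, ← h, hℓ, div_eq_one_iff_eq hpow.ne'] at hone
    exact hMn.ne (by exact_mod_cast hone)
  refine ⟨⌊ℓ⌋₊, (Int.natCast_floor_eq_floor hℓ0).symm, ?_, ?_⟩
  · exact (Nat.floor_lt hℓ0).2 (lt_of_le_of_ne hmem.2 hℓn)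
  · rwa [binCDF_three_quarters (Int.natCast_floor_eq_floor hℓ0).symm, div_left_inj' hpow.ne',
      eq_comm] at hℓ

theorem binCDFInv_three_quarters {n M : ℕ} (hM0 : 1 ≤ M) (hMn : M < 4 ^ n) {ℓ : ℝ}
    (hℓ : ℓ = binCDFInv n (3 / 4) ((M : ℝ) / 4 ^ n)) :
    ∃ L : ℕ, ⌊ℓ⌋ = L ∧ L < n ∧
      (M : ℝ) = cumCount n (L + 1) + Int.fract ℓ * (n.choose (L + 1) * 3 ^ (L + 1)) := by
  have hMn' : (M : ℝ) ≤ 4 ^ n := by exact_mod_cast hMn.le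
  have himage : (M : ℝ) / 4 ^ n ∈ binCDF n (3 / 4) '' Set.Icc (-1) n :=
    surjOn_binCDF n _ ⟨by positivity, div_le_one_of_le₀ hMn' (by positivity)⟩
  exact exists_floor_eq_of_binCDF_three_quarters_eq hM0 hMn (hℓ ▸ Function.invFunOn_mem himage)
    (hℓ ▸ Function.invFunOn_eq himage)

end BinCDF

/-! ### The error bounds of the depolarizing law -/

section Bounds

variable {n : ℕ} {δ : ℝ}

theorem cumCount_le_of_eq_add_fract_mul {L M : ℕ} {ℓ : ℝ}
    (hM : (M : ℝ) = cumCount n (L + 1) + Int.fract ℓ * (n.choose (L + 1) * 3 ^ (L + 1))) :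
    cumCount n (L + 1) ≤ M ∧ M ≤ cumCount n (L + 2) := by
  have hblock : (0 : ℝ) ≤ n.choose (L + 1) * 3 ^ (L + 1) := by positivity
  constructor
  · have : (cumCount n (L + 1) : ℝ) ≤ M := by
      rw [hM]
      exact le_add_of_nonneg_right (mul_nonneg (Int.fract_nonneg ℓ) hblock)
    exact_mod_cast this
  · have : (M : ℝ) ≤ (cumCount n (L + 2) : ℕ) := by
      rw [hM, cumCount_succ n (L + 1)]
      push_cast
      exact add_le_add_right (mul_le_of_le_one_left hblock (Int.fract_lt_one ℓ).le) _
    exact_mod_cast this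

theorem sum_weightProb_mul_cumCount_sub (i : ℕ) :
    ∑ j ∈ range (i + 1), weightProb n δ j * ((cumCount n (j + 1) : ℝ) - cumCount n j) =
      binCDFInt n δ i := by
  refine sum_congr rfl fun j _ => ?_
  rw [cumCount_succ, ← choose_mul_weightProb]
  push_cast
  ring

theorem IsSortedOrder.sum_position_le_eq_binCDF (h0 : 0 ≤ δ) (h1 : δ ≤ 3 / 4)
    {o : Fin (2 ^ (2 * n)) ≃ PVec n} (ho : IsSortedOrder (depolarizingLaw n δ) o) {L M : ℕ} {ℓ : ℝ}
    (hL : ⌊ℓ⌋ = L) (hLn : L < n)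
    (hM : (M : ℝ) = cumCount n (L + 1) + Int.fract ℓ * (n.choose (L + 1) * 3 ^ (L + 1))) :
    ∑ u with position o u ≤ M, depolarizingLaw n δ u = binCDF n δ ℓ := by
  obtain ⟨hLM, hML⟩ := cumCount_le_of_eq_add_fract_mul hM
  have hlist := ho.sum_range_listProb_mul_sub h0 h1 (fun j => (j : ℝ)) hLn hLM hML
  have hpos := sum_position_le (depolarizingLaw n δ) o M fun _ => 1
  simp only [Nat.cast_succ, add_sub_cancel_left, mul_one] at hlist hpos
  have hblock : weightProb n δ (L + 1) * ((M : ℝ) - cumCount n (L + 1)) =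
      Int.fract ℓ * (binCDFInt n δ (L + 1) - binCDFInt n δ L) := by
    rw [hM, binCDFInt_natCast_add_one, ← choose_mul_weightProb]
    ring
  rw [hpos, hlist, sum_weightProb_mul_cumCount_sub, hblock, binCDF, hL]

theorem errorConverse_depolarizingLaw (h0 : 0 ≤ δ) (h1 : δ ≤ 3 / 4)
    {o : Fin (2 ^ (2 * n)) ≃ PVec n} (ho : IsSortedOrder (depolarizingLaw n δ) o) {m : ℕ}
    (hm : 2 ^ m < 4 ^ n) {ℓ : ℝ} (hℓ : ℓ = binCDFInv n (3 / 4) ((2 : ℝ) ^ m / 4 ^ n)) :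
    errorConverse (depolarizingLaw n δ) o m = binCDF n (1 - δ) (n - 1 - ℓ) := by
  obtain ⟨L, hL, hLn, hM⟩ :=
    binCDFInv_three_quarters Nat.one_le_two_pow hm (hℓ.trans (by push_cast; rfl))
  rw [errorConverse_eq_one_sub (sum_depolarizingLaw n δ),
    ho.sum_position_le_eq_binCDF h0 h1 hL hLn hM, binCDF_reflect]

theorem weightProb_eq_mul_pow (hδ : δ ≠ 1) {i : ℕ} (hi : i ≤ n) :
    weightProb n δ i = (1 - δ) ^ n * (δ / (3 - 3 * δ)) ^ i := by
  have hcompl : 1 - δ ≠ 0 := sub_ne_zero.2 hδ.symm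
  have hratio : (1 - δ) * (δ / (3 - 3 * δ)) = δ / 3 := by
    rw [show 3 - 3 * δ = 3 * (1 - δ) by ring]
    field_simp
  rw [weightProb, ← hratio, mul_pow, mul_right_comm, ← pow_add, Nat.add_sub_of_le hi]

theorem sum_weightProb_sub_mul_cumCount_sq (hδ : δ ≠ 1) {L : ℕ} (hL : L < n) :
    ∑ i ∈ range (L + 1), (weightProb n δ i - weightProb n δ (i + 1)) *
        (cumCount n (i + 1) : ℝ) ^ 2 =
      (16 - 16 * δ) ^ n * ((3 - 4 * δ) / (3 - 3 * δ)) *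
        ∑ i ∈ range (L + 1), (δ / (3 - 3 * δ)) ^ i * binCDF n (3 / 4) i ^ 2 := by
  have hden : 3 - 3 * δ ≠ 0 := fun h => hδ (by linarith)
  have hratio : (3 - 4 * δ) / (3 - 3 * δ) = 1 - δ / (3 - 3 * δ) := by
    field_simp
    ring
  have hpow : (16 - 16 * δ) ^ n = (1 - δ) ^ n * ((4 : ℝ) ^ n) ^ 2 := by
    rw [← pow_mul, mul_comm n, pow_mul, ← mul_pow]
    ring
  rw [mul_sum]
  refine sum_congr rfl fun i hi => ?_
  have hiL := mem_range.1 hi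
  have hcdf : binCDF n (3 / 4) i = cumCount n (i + 1) / 4 ^ n :=
    (binCDF_intCast n (3 / 4) i).trans (binCDFInt_three_quarters n i)
  rw [hcdf, weightProb_eq_mul_pow hδ (by lia), weightProb_eq_mul_pow hδ (by lia), hratio, hpow,
    div_pow _ ((4 : ℝ) ^ n), pow_succ (δ / (3 - 3 * δ)) i]
  generalize δ / (3 - 3 * δ) = ρ
  field_simp

theorem IsSortedOrder.sum_position_le_mul_sub_one (h0 : 0 ≤ δ) (h1 : δ ≤ 3 / 4)
    {o : Fin (2 ^ (2 * n)) ≃ PVec n} (ho : IsSortedOrder (depolarizingLaw n δ) o) {L M : ℕ}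
    (hLn : L < n) (hLM : cumCount n (L + 1) ≤ M) (hML : M ≤ cumCount n (L + 2)) :
    ∑ u with position o u ≤ M, depolarizingLaw n δ u * (position o u - 1 : ℝ) =
      (weightProb n δ (L + 1) * (M : ℝ) ^ 2 +
        ∑ i ∈ range (L + 1), (weightProb n δ i - weightProb n δ (i + 1)) *
          (cumCount n (i + 1) : ℝ) ^ 2 -
        ∑ u with position o u ≤ M, depolarizingLaw n δ u) / 2 := by
  rw [sum_position_le_sub_one,
    ho.sum_range_listProb_mul_sub h0 h1 (fun j => (j : ℝ) ^ 2) hLn hLM hML,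
    sum_range_mul_sub_add_mul_sub (weightProb n δ) (fun i => (cumCount n i : ℝ) ^ 2)
      (by simp [cumCount_zero])]

theorem errorAchievability_depolarizingLaw (h0 : 0 ≤ δ) (h1 : δ ≤ 3 / 4)
    {o : Fin (2 ^ (2 * n)) ≃ PVec n} (ho : IsSortedOrder (depolarizingLaw n δ) o) {m : ℕ}
    (hm : 2 ^ m < 4 ^ n) {ℓ : ℝ} (hℓ : ℓ = binCDFInv n (3 / 4) ((2 : ℝ) ^ m / 4 ^ n)) :
    errorAchievability (depolarizingLaw n δ) o m =
      (1 + 1 / (2 : ℝ) ^ (m + 1)) * binCDF n (1 - δ) (n - 1 - ℓ)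
        - 1 / (2 : ℝ) ^ (m + 1)
        + (2 : ℝ) ^ ((m : ℤ) - 1) * (1 - δ) ^ n * (δ / (3 - 3 * δ)) ^ (⌊ℓ⌋ + 1)
        + (16 - 16 * δ) ^ n / (2 : ℝ) ^ (m + 1) * ((3 - 4 * δ) / (3 - 3 * δ))
          * ∑ i ∈ range (⌊ℓ⌋₊ + 1), (δ / (3 - 3 * δ)) ^ i * binCDF n (3 / 4) i ^ 2 := by
  have hδ : δ ≠ 1 := by linarith
  have hconverse := errorConverse_depolarizingLaw h0 h1 ho hm hℓ
  obtain ⟨L, hL, hLn, hM⟩ :=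
    binCDFInv_three_quarters Nat.one_le_two_pow hm (hℓ.trans (by push_cast; rfl))
  obtain ⟨hLM, hML⟩ := cumCount_le_of_eq_add_fract_mul hM
  have hfloor : ⌊ℓ⌋₊ = L := by rw [← Int.floor_toNat, hL, Int.toNat_natCast]
  have hzpow : (δ / (3 - 3 * δ)) ^ (⌊ℓ⌋ + 1) = (δ / (3 - 3 * δ)) ^ (L + 1) := by
    rw [hL]
    exact_mod_cast zpow_natCast (δ / (3 - 3 * δ)) (L + 1)
  have hhead : ∑ u with position o u ≤ 2 ^ m, depolarizingLaw n δ u =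
      1 - binCDF n (1 - δ) (n - 1 - ℓ) := by
    rw [← hconverse, errorConverse_eq_one_sub (sum_depolarizingLaw n δ), sub_sub_cancel]
  rw [errorAchievability_eq_add, ho.sum_position_le_mul_sub_one h0 h1 hLn hLM hML, hconverse, hhead,
    weightProb_eq_mul_pow hδ hLn, sum_weightProb_sub_mul_cumCount_sq hδ hLn, hfloor, hzpow,
    zpow_sub_one₀ two_ne_zero, zpow_natCast, pow_succ (2 : ℝ) m]
  push_cast
  generalize binCDF n (1 - δ) (n - 1 - ℓ) = c, (1 - δ) ^ n = x, (16 - 16 * δ) ^ n = y,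
    (3 - 4 * δ) / (3 - 3 * δ) = z, (δ / (3 - 3 * δ)) ^ (L + 1) = w
  field_simp
  ring

end Bounds

/-! ### Truncated exponential moments and the number of vectors of small weight -/

section Geometric

theorem sum_range_ite_pow_le {x : ℝ} (hx : 1 < x) (N : ℕ) (t : ℝ) :
    ∑ k ∈ range N, (if (k : ℝ) ≤ t then x ^ k else 0) ≤ x ^ t / (1 - x⁻¹) := by
  have hx0 : 0 < x := one_pos.trans hx
  have hx1 : 0 < x - 1 := sub_pos.2 hx
  have hinv : 1 - x⁻¹ = (x - 1) / x := by field_simp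
  rw [hinv]
  rcases lt_or_ge t 0 with ht | ht
  · rw [sum_eq_zero fun k _ => if_neg (ht.trans_le (Nat.cast_nonneg k)).not_ge]
    positivity
  calc ∑ k ∈ range N, (if (k : ℝ) ≤ t then x ^ k else 0)
      ≤ ∑ k ∈ range (⌊t⌋₊ + 1), x ^ k := by
        rw [← sum_filter]
        refine sum_le_sum_of_subset_of_nonneg (fun k hk => ?_) fun k _ _ => by positivity
        exact mem_range_succ_iff.2 (Nat.le_floor (mem_filter.1 hk).2)
    _ = (x * x ^ ⌊t⌋₊ - 1) / (x - 1) := by rw [geom_sum_eq hx.ne', pow_succ']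
    _ ≤ x * x ^ ⌊t⌋₊ / (x - 1) := by gcongr; linarith
    _ = x ^ (⌊t⌋₊ : ℝ) / ((x - 1) / x) := by rw [Real.rpow_natCast]; field_simp
    _ ≤ x ^ t / ((x - 1) / x) := by gcongr; exacts [hx.le, Nat.floor_le ht]

theorem binE_ite_pow_le {n : ℕ} {p : ℝ} (hn : n ≠ 0) (h0 : 0 < p) (h1 : p < 1) {x : ℝ}
    (hx : 1 < x) (t : ℝ) :
    binE n p (fun k => if (k : ℝ) ≤ t then x ^ k else 0) ≤ x ^ t / ((1 - x⁻¹) * binSD n p) := by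
  have hx0 : 0 < x := one_pos.trans hx
  have hSD := binSD_pos hn h0 h1
  rw [← div_div]
  exact (binE_le_sum_div_binSD hn h0 h1 fun k => by positivity).trans <| by
    gcongr
    exact sum_range_ite_pow_le hx _ t

end Geometric

section WeightRatio

variable {n : ℕ} {δ : ℝ}

/-- The factor by which the probability of a vector under the depolarizing law drops when its
weight grows by one. -/
def weightRatio (δ : ℝ) : ℝ := 3 * (1 - δ) / δ

theorem weightRatio_pos (h0 : 0 < δ) (h1 : δ < 1) : 0 < weightRatio δ :=
  div_pos (by linarith) h0

theorem one_le_weightRatio (h0 : 0 < δ) (h1 : δ ≤ 3 / 4) : 1 ≤ weightRatio δ :=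
  (one_le_div h0).2 (by linarith)

theorem one_lt_weightRatio (h0 : 0 < δ) (h1 : δ < 3 / 4) : 1 < weightRatio δ :=
  (one_lt_div h0).2 (by linarith)

theorem weightProb_mul_weightRatio_pow (h0 : δ ≠ 0) {w : ℕ} (hw : w ≤ n) :
    weightProb n δ w * weightRatio δ ^ w = (1 - δ) ^ n := by
  have hcancel : δ / 3 * weightRatio δ = 1 - δ := by
    rw [weightRatio]
    field_simp
  rw [weightProb, mul_right_comm, ← mul_pow, hcancel, ← pow_add, Nat.add_sub_of_le hw]

theorem weightProb_le_div_rpow (h0 : 0 < δ) (h1 : δ ≤ 3 / 4) {w : ℕ} (hw : w ≤ n) {t : ℝ}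
    (ht : t ≤ w) : weightProb n δ w ≤ (1 - δ) ^ n / weightRatio δ ^ t := by
  have hratio := one_le_weightRatio h0 h1
  have hcompl : 0 < 1 - δ := by linarith
  rw [← weightProb_mul_weightRatio_pow h0.ne' hw, ← Real.rpow_natCast,
    le_div_iff₀ (Real.rpow_pos_of_pos (one_pos.trans_le hratio) t)]
  have hprob : 0 ≤ weightProb n δ w := by
    rw [weightProb]
    positivity
  gcongr

theorem card_weight_le_eq_binE (h0 : 0 < δ) (h1 : δ < 1) (w : ℕ) :
    (#{v : PVec n | weight v ≤ w} : ℝ) =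
      binE n δ (fun k => if (k : ℝ) ≤ w then weightRatio δ ^ k else 0) / (1 - δ) ^ n := by
  have hcompl : (1 - δ) ^ n ≠ 0 := pow_ne_zero n (by linarith)
  rw [← sum_depolarizingLaw_mul, ← sum_boole, sum_div]
  refine sum_congr rfl fun v _ => ?_
  rw [depolarizingLaw_eq_weightProb, mul_ite, mul_zero,
    weightProb_mul_weightRatio_pow h0.ne' (weight_le v), ite_div, div_self hcompl, zero_div]
  simp only [Nat.cast_le]

theorem card_weight_le_le (hn : n ≠ 0) (h0 : 0 < δ) (h1 : δ < 3 / 4) (w : ℕ) :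
    (#{v : PVec n | weight v ≤ w} : ℝ) ≤
      weightRatio δ ^ w / ((1 - (weightRatio δ)⁻¹) * binSD n δ) / (1 - δ) ^ n := by
  have h1' : δ < 1 := by linarith
  have hcompl : 0 < 1 - δ := by linarith
  have hmoment := binE_ite_pow_le hn h0 h1' (one_lt_weightRatio h0 h1) w
  rw [Real.rpow_natCast] at hmoment
  rw [card_weight_le_eq_binE h0 h1']
  gcongr

theorem sum_mul_card_weight_le_le (hn : n ≠ 0) (h0 : 0 < δ) (h1 : δ < 3 / 4) (t : ℝ) :
    ∑ u : PVec n, depolarizingLaw n δ u *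
        (if (weight u : ℝ) ≤ t then (#{v : PVec n | weight v ≤ weight u} : ℝ) else 0) ≤
      weightRatio δ ^ t / ((1 - δ) ^ n * ((1 - (weightRatio δ)⁻¹) * binSD n δ) ^ 2) := by
  have h1' : δ < 1 := by linarith
  have hcompl : 0 < 1 - δ := by linarith
  have hratio := one_lt_weightRatio h0 h1
  have hSD := binSD_pos hn h0 h1'
  have hgap : 0 < 1 - (weightRatio δ)⁻¹ := sub_pos.2 (inv_lt_one_of_one_lt₀ hratio)
  set c := (1 - (weightRatio δ)⁻¹) * binSD n δ
  have hc0 : 0 < c := mul_pos hgap hSD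
  calc _ ≤ ∑ u : PVec n, depolarizingLaw n δ u *
        (1 / (c * (1 - δ) ^ n) * if (weight u : ℝ) ≤ t then weightRatio δ ^ weight u else 0) := by
        refine sum_le_sum fun u _ =>
          mul_le_mul_of_nonneg_left ?_ (depolarizingLaw_nonneg h0.le h1'.le u)
        split_ifs
        · refine (card_weight_le_le hn h0 h1 _).trans_eq ?_
          rw [div_div, one_div_mul_eq_div]
        · rw [mul_zero]
    _ = 1 / (c * (1 - δ) ^ n) *
        binE n δ fun k => if (k : ℝ) ≤ t then weightRatio δ ^ k else 0 := by
        rw [← binE_const_mul]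
        exact sum_depolarizingLaw_mul n δ fun k =>
          1 / (c * (1 - δ) ^ n) * if (k : ℝ) ≤ t then weightRatio δ ^ k else 0
    _ ≤ 1 / (c * (1 - δ) ^ n) * (weightRatio δ ^ t / c) := by
        gcongr
        exact binE_ite_pow_le hn h0 h1' hratio t
    _ = weightRatio δ ^ t / ((1 - δ) ^ n * c ^ 2) := by field_simp

theorem sum_depolarizingLaw_mul_min_le (hn : n ≠ 0) (h0 : 0 < δ) (h1 : δ < 3 / 4) (m : ℕ)
    (t : ℝ) :
    ∑ u : PVec n, depolarizingLaw n δ u *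
        min 1 ((#{v | v ≠ u ∧ weight v ≤ weight u} : ℝ) / 2 ^ m) ≤
      1 - binProbLE n δ t +
        weightRatio δ ^ t / ((1 - δ) ^ n * ((1 - (weightRatio δ)⁻¹) * binSD n δ) ^ 2) / 2 ^ m := by
  have htail : ∑ u : PVec n, depolarizingLaw n δ u * (1 - if (weight u : ℝ) ≤ t then 1 else 0) =
      1 - binProbLE n δ t := by
    rw [sum_depolarizingLaw_mul n δ fun k => 1 - if (k : ℝ) ≤ t then 1 else 0, binE_sub, binE_const,
      binProbLE]
  grw [← sum_mul_card_weight_le_le hn h0 h1 t, ← htail]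
  rw [sum_div, ← sum_add_distrib]
  refine sum_le_sum fun u _ => ?_
  rw [mul_div_assoc, ← mul_add]
  refine mul_le_mul_of_nonneg_left ?_ (depolarizingLaw_nonneg h0.le (by linarith) u)
  split_ifs
  · rw [sub_self, zero_add]
    refine (min_le_right _ _).trans ?_
    gcongr with v
    exact And.right
  · simp

end WeightRatio

/-! ### The optimal rate -/

section SyndromeBits

variable {δ : ℝ}

/-- The number of syndrome bits that is needed, up to a bounded error, when `z` is the standard
normal quantile of the success probability. -/
def syndromeBits (δ z : ℝ) (n : ℕ) : ℝ :=
  Real.logb 2 (weightRatio δ) * (n * δ + binSD n δ * z) - Real.logb 2 (1 - δ) * n -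
    Real.logb 2 n / 2

theorem logb_binSD (h0 : 0 < δ) (h1 : δ < 1) {n : ℕ} (hn : n ≠ 0) :
    Real.logb 2 (binSD n δ) = Real.logb 2 √(δ * (1 - δ)) + Real.logb 2 n / 2 := by
  have hvar : 0 < δ * (1 - δ) := mul_pos h0 (by linarith)
  have hn' : (0 : ℝ) < n := by positivity
  rw [binSD_eq, Real.logb_mul (Real.sqrt_pos.2 hvar).ne' (Real.sqrt_pos.2 hn').ne', Real.logb,
    Real.logb, Real.logb, Real.log_sqrt hn'.le]
  ring

theorem logb_weightRatio_rpow_div (h0 : 0 < δ) (h1 : δ < 1) {n : ℕ} (hn : n ≠ 0) (z a : ℝ) :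
    Real.logb 2 (weightRatio δ ^ (n * δ + binSD n δ * z + a) / ((1 - δ) ^ n * binSD n δ)) =
      syndromeBits δ z n +
        (Real.logb 2 (weightRatio δ) * a - Real.logb 2 √(δ * (1 - δ))) := by
  have hratio := weightRatio_pos h0 h1
  have hSD := binSD_pos hn h0 h1
  have hcompl : 0 < 1 - δ := by linarith
  rw [Real.logb_div (by positivity) (by positivity), Real.logb_mul (by positivity) hSD.ne',
    Real.logb_rpow_eq_mul_logb_of_pos hratio, Real.logb_pow, logb_binSD h0 h1 hn, syndromeBits]
  ring

theorem one_sub_hashingBound (h0 : 0 < δ) (h1 : δ < 1) :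
    1 - hashingBound δ = δ * Real.logb 2 (weightRatio δ) - Real.logb 2 (1 - δ) := by
  have hcompl : 1 - δ ≠ 0 := by linarith
  rw [hashingBound, binEntropyTwo, weightRatio,
    Real.logb_div (mul_ne_zero three_ne_zero hcompl) h0.ne', Real.logb_mul three_ne_zero hcompl]
  ring

theorem hashingBound_lt_one (h0 : 0 < δ) (h1 : δ ≤ 3 / 4) : hashingBound δ < 1 := by
  have hratio := Real.logb_nonneg one_lt_two (one_le_weightRatio h0 h1)
  have hcompl := Real.logb_neg one_lt_two (x := 1 - δ) (by linarith) (by linarith)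
  have := one_sub_hashingBound h0 (h1.trans_lt (by norm_num))
  nlinarith

theorem hashingBound_three_quarters : hashingBound (3 / 4) = -1 := by
  have hlog : Real.logb 2 (1 - 3 / 4) = -2 := by
    rw [show (1 : ℝ) - 3 / 4 = (2 ^ 2)⁻¹ by norm_num, Real.logb_inv, Real.logb_pow,
      Real.logb_self_eq_one one_lt_two]
    norm_num
  have hone := one_sub_hashingBound (δ := 3 / 4) (by norm_num) (by norm_num)
  rw [hlog, show weightRatio (3 / 4) = 1 by norm_num [weightRatio], Real.logb_one] at hone
  linarith

theorem sub_syndromeBits (h0 : 0 < δ) (h1 : δ < 1) (x : ℝ) {n : ℕ} (hn : n ≠ 0) :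
    n - syndromeBits δ (-x) n = n * (hashingBound δ
      - √(δ * (1 - δ) / n) * x * Real.logb 2 (δ / (3 * (1 - δ)))
      + Real.logb 2 n / (2 * n)) := by
  have hn' : (0 : ℝ) < n := by positivity
  have hsqrt : √(δ * (1 - δ) / n) = binSD n δ / n := by
    rw [binSD_eq, Real.sqrt_div' _ hn'.le, div_eq_div_iff (Real.sqrt_pos.2 hn').ne' hn'.ne',
      mul_assoc, Real.mul_self_sqrt hn'.le]
  have hlog : Real.logb 2 (δ / (3 * (1 - δ))) = -Real.logb 2 (weightRatio δ) := by
    rw [weightRatio, ← Real.logb_inv, inv_div]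
  have hbound : hashingBound δ = 1 - (δ * Real.logb 2 (weightRatio δ) - Real.logb 2 (1 - δ)) := by
    rw [← one_sub_hashingBound h0 h1, sub_sub_cancel]
  rw [hsqrt, hlog, hbound, syndromeBits]
  field_simp
  ring

theorem tendsto_syndromeBits_div (h0 : 0 < δ) (h1 : δ < 1) (z : ℝ) :
    Tendsto (fun n : ℕ => syndromeBits δ z n / n) atTop (𝓝 (1 - hashingBound δ)) := by
  have hSD : Tendsto (fun n : ℕ => √(δ * (1 - δ) / n)) atTop (𝓝 0) := by
    have := (tendsto_const_div_atTop_nhds_zero_nat (δ * (1 - δ))).sqrt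
    rwa [Real.sqrt_zero] at this
  have hlog : Tendsto (fun n : ℕ => Real.logb 2 n / (2 * n)) atTop (𝓝 0) := by
    have := ((Real.tendsto_pow_log_div_mul_add_atTop (2 * Real.log 2) 0 1
      (by positivity)).comp tendsto_natCast_atTop_atTop)
    refine this.congr fun n => ?_
    rw [Function.comp_apply, pow_one, add_zero, Real.logb, div_div, mul_left_comm, mul_assoc]
  have hlim := (((hSD.mul_const (-z)).mul_const (Real.logb 2 (δ / (3 * (1 - δ))))).const_sub
    (hashingBound δ)).add hlog |>.const_sub 1
  simp only [zero_mul, sub_zero, add_zero] at hlim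
  refine hlim.congr' ?_
  filter_upwards [eventually_ne_atTop 0] with n hn
  have hn' : (n : ℝ) ≠ 0 := Nat.cast_ne_zero.2 hn
  have hsub := sub_syndromeBits h0 h1 (-z) hn
  rw [neg_neg] at hsub
  rw [eq_div_iff hn', sub_mul, one_mul, mul_comm _ (n : ℝ), ← hsub, sub_sub_cancel]

theorem tendsto_syndromeBits_atTop (h0 : 0 < δ) (h1 : δ ≤ 3 / 4) (z : ℝ) :
    Tendsto (syndromeBits δ z) atTop atTop := by
  have hlim := tendsto_syndromeBits_div h0 (h1.trans_lt (by norm_num)) z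
  refine (tendsto_natCast_atTop_atTop.atTop_mul_pos (sub_pos.2 (hashingBound_lt_one h0 h1))
    hlim).congr' ?_
  filter_upwards [eventually_ne_atTop 0] with n hn
  exact mul_div_cancel₀ _ (Nat.cast_ne_zero.2 hn)

theorem tendsto_sub_syndromeBits_div (h0 : 0 < δ) (h1 : δ < 1) (z : ℝ) :
    Tendsto (fun n : ℕ => (n - syndromeBits δ z n) / n) atTop (𝓝 (hashingBound δ)) := by
  have hlim := (tendsto_syndromeBits_div h0 h1 z).const_sub 1
  rw [sub_sub_cancel] at hlim
  refine hlim.congr' ?_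
  filter_upwards [eventually_ne_atTop 0] with n hn
  rw [sub_div, div_self (Nat.cast_ne_zero.2 hn)]

theorem tendsto_sub_syndromeBits_atTop (h0 : 0 < δ) (h1 : δ < 1) (hpos : 0 < hashingBound δ)
    (z : ℝ) : Tendsto (fun n : ℕ => n - syndromeBits δ z n) atTop atTop := by
  refine (tendsto_natCast_atTop_atTop.atTop_mul_pos hpos
    (tendsto_sub_syndromeBits_div h0 h1 z)).congr' ?_
  filter_upwards [eventually_ne_atTop 0] with n hn
  exact mul_div_cancel₀ _ (Nat.cast_ne_zero.2 hn)

theorem eventually_sub_syndromeBits_nonpos (h0 : 0 < δ) (h1 : δ < 1) (hneg : hashingBound δ < 0)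
    (z : ℝ) : ∀ᶠ n : ℕ in atTop, n - syndromeBits δ z n ≤ 0 := by
  filter_upwards [(tendsto_sub_syndromeBits_div h0 h1 z).eventually_lt_const hneg,
    eventually_gt_atTop 0] with n hn hn0
  have hn' : (0 : ℝ) < n := by positivity
  exact (neg_of_div_neg_left hn hn'.le).le

end SyndromeBits

section Guessing

variable {δ ε z : ℝ}

theorem exists_syndromeBits_sub_le_of_guessErrorProb_le (h0 : 0 < δ) (h1 : δ ≤ 3 / 4)
    (hz : normalCDF z = 1 - ε) :
    ∃ K : ℝ, ∀ᶠ n : ℕ in atTop, ∀ (m : ℕ) (hm : m ≤ n)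
      (C : Matrix (Fin (2 * n)) (Fin (2 * n)) (ZMod 2)) (D : (Fin m → ZMod 2) → PVec n),
      guessErrorProb hm (depolarizingLaw n δ) C D ≤ ε → syndromeBits δ z n - K ≤ m := by
  have h1' : δ < 1 := by linarith
  have hcompl : 0 < 1 - δ := by linarith
  have hratio := weightRatio_pos h0 h1'
  obtain ⟨a, ha⟩ := exists_binProbLE_quantile h0 h1' z
  refine ⟨Real.logb 2 (weightRatio δ) * a + Real.logb 2 √(δ * (1 - δ)), ?_⟩
  filter_upwards [ha, eventually_ne_atTop 0] with n ⟨hquantile, _⟩ hn m hm C D hε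
  have hSD := binSD_pos hn h0 h1'
  have hlog := logb_weightRatio_rpow_div h0 h1' hn z (-a)
  rw [← sub_eq_add_neg] at hlog
  set t := n * δ + binSD n δ * z - a
  have hcorrect := one_sub_guessErrorProb_le hm (depolarizingLaw_nonneg h0.le h1'.le)
    (sum_depolarizingLaw n δ) {u | (weight u : ℝ) ≤ t}
    (B := (1 - δ) ^ n / weightRatio δ ^ t) (by positivity) (fun u hu => by
      rw [mem_filter_univ, not_le] at hu
      rw [depolarizingLaw_eq_weightProb]
      exact weightProb_le_div_rpow h0 h1 (weight_le u) hu.le) C D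
  have hlight : ∑ u with (weight u : ℝ) ≤ t, depolarizingLaw n δ u = binProbLE n δ t := by
    rw [binProbLE, ← sum_depolarizingLaw_mul, sum_filter]
    simp only [mul_ite, mul_one, mul_zero]
  have hlist : weightRatio δ ^ t / ((1 - δ) ^ n * binSD n δ) ≤ 2 ^ (m : ℝ) := by
    have hgap : 1 / binSD n δ ≤ 2 ^ m * ((1 - δ) ^ n / weightRatio δ ^ t) := by linarith
    rw [Real.rpow_natCast]
    calc _ = weightRatio δ ^ t / (1 - δ) ^ n * (1 / binSD n δ) := by field_simp
      _ ≤ weightRatio δ ^ t / (1 - δ) ^ n * (2 ^ m * ((1 - δ) ^ n / weightRatio δ ^ t)) := by gcongr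
      _ = 2 ^ m := by field_simp
  have := (Real.logb_le_iff_le_rpow one_lt_two (by positivity)).2 hlist
  linarith

theorem exists_guessErrorProb_le_of_syndromeBits_add_le (h0 : 0 < δ) (h1 : δ < 3 / 4)
    (hz : normalCDF z = 1 - ε) :
    ∃ K : ℝ, ∀ᶠ n : ℕ in atTop, ∀ (m : ℕ) (hm : m ≤ n), syndromeBits δ z n + K ≤ m →
      ∃ C ∈ symplecticSet n, ∃ D, guessErrorProb hm (depolarizingLaw n δ) C D ≤ ε := by
  have h1' : δ < 1 := by linarith
  have hcompl : 0 < 1 - δ := by linarith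
  have hratio := one_lt_weightRatio h0 h1
  have hratio0 := weightRatio_pos h0 h1'
  have hc0 : 0 < 1 - (weightRatio δ)⁻¹ := sub_pos.2 (inv_lt_one_of_one_lt₀ hratio)
  obtain ⟨a, ha⟩ := exists_binProbLE_quantile h0 h1' z
  set c := 1 - (weightRatio δ)⁻¹
  refine ⟨Real.logb 2 (weightRatio δ) * a - Real.logb 2 √(δ * (1 - δ)) - Real.logb 2 (c ^ 2), ?_⟩
  filter_upwards [ha, eventually_ne_atTop 0] with n ⟨_, hquantile⟩ hn m hm hbits
  have hSD := binSD_pos hn h0 h1'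
  have hlog := logb_weightRatio_rpow_div h0 h1' hn z a
  set t := n * δ + binSD n δ * z + a
  obtain ⟨C, hC, D, hD⟩ := exists_guessErrorProb_le_sum_min hm (weight (n := n))
    (depolarizingLaw_nonneg h0.le h1'.le)
  refine ⟨C, hC, D, (hD.trans (sum_depolarizingLaw_mul_min_le hn h0 h1 m t)).trans ?_⟩
  have hlist : weightRatio δ ^ t / ((1 - δ) ^ n * binSD n δ) / c ^ 2 ≤ 2 ^ (m : ℝ) := by
    refine (Real.logb_le_iff_le_rpow one_lt_two (by positivity)).1 ?_
    rw [Real.logb_div (by positivity) (by positivity), hlog]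
    linarith
  have hgap : weightRatio δ ^ t / ((1 - δ) ^ n * (c * binSD n δ) ^ 2) / 2 ^ m ≤ 1 / binSD n δ := by
    rw [Real.rpow_natCast] at hlist
    rw [div_le_iff₀ (by positivity)]
    calc _ = 1 / binSD n δ * (weightRatio δ ^ t / ((1 - δ) ^ n * binSD n δ) / c ^ 2) := by
          field_simp
      _ ≤ 1 / binSD n δ * 2 ^ m := by gcongr
  linarith

end Guessing

section Rate

theorem mem_guessRates {n m : ℕ} (hm : m ≤ n) {p : PVec n → ℝ} {ε : ℝ}
    {C : Matrix (Fin (2 * n)) (Fin (2 * n)) (ZMod 2)} (hC : C ∈ symplecticSet n)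
    {D : (Fin m → ZMod 2) → PVec n} (h : guessErrorProb hm p C D ≤ ε) :
    ((n : ℝ) - m) / n ∈ guessRates p ε :=
  ⟨m, n - m, Nat.add_sub_of_le hm, by rw [Nat.cast_sub hm], C, hC, D, h⟩

theorem exists_isErrorGuessRate {n : ℕ} {p : PVec n → ℝ} {ε : ℝ} (h : (guessRates p ε).Nonempty) :
    ∃ R, IsErrorGuessRate p ε R := by
  refine IsCompact.exists_isGreatest (Set.Finite.isCompact ?_) h
  refine ((range (n + 1)).image fun k : ℕ => (k : ℝ) / n).finite_toSet.subset ?_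
  rintro r ⟨m, k, hmk, rfl, -⟩
  exact mem_coe.2 (mem_image.2 ⟨k, mem_range.2 (by lia), rfl⟩)

theorem IsErrorGuessRate.nonneg {n : ℕ} {p : PVec n → ℝ} {ε R : ℝ} (hR : IsErrorGuessRate p ε R) :
    0 ≤ R := by
  obtain ⟨⟨m, k, -, rfl, -⟩, -⟩ := hR
  positivity

variable {δ ε z : ℝ}

theorem exists_mem_guessRates_ge (h0 : 0 < δ) (h1 : δ < 3 / 4) (hz : normalCDF z = 1 - ε) :
    ∃ K : ℝ, ∀ᶠ n : ℕ in atTop, syndromeBits δ z n + K ≤ n →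
      ∃ r ∈ guessRates (depolarizingLaw n δ) ε, n - syndromeBits δ z n - (K + 1) ≤ n * r := by
  obtain ⟨K, hK⟩ := exists_guessErrorProb_le_of_syndromeBits_add_le h0 h1 hz
  refine ⟨K, ?_⟩
  filter_upwards [hK, (tendsto_syndromeBits_atTop h0 h1.le z).eventually_ge_atTop (-K),
    eventually_ne_atTop 0] with n hguess hbits hn hle
  have hm : ⌈syndromeBits δ z n + K⌉₊ ≤ n := Nat.ceil_le.2 hle
  obtain ⟨C, hC, D, hD⟩ := hguess _ hm (Nat.le_ceil _)
  refine ⟨_, mem_guessRates hm hC hD, ?_⟩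
  rw [mul_div_cancel₀ _ (Nat.cast_ne_zero.2 hn)]
  linarith [Nat.ceil_lt_add_one (show 0 ≤ syndromeBits δ z n + K by linarith)]

theorem eventually_exists_isErrorGuessRate (h0 : 0 < δ) (h1 : δ ≤ 3 / 4)
    (hz : normalCDF z = 1 - ε) (hpos : 0 < hashingBound δ) :
    ∀ᶠ n : ℕ in atTop, ∃ R, IsErrorGuessRate (depolarizingLaw n δ) ε R := by
  have hδ : δ < 3 / 4 := by
    refine lt_of_le_of_ne h1 ?_
    rintro rfl
    linarith [hashingBound_three_quarters]
  obtain ⟨K, hK⟩ := exists_mem_guessRates_ge h0 hδ hz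
  filter_upwards [hK, (tendsto_sub_syndromeBits_atTop h0 (by linarith) hpos
    z).eventually_ge_atTop K] with n hrate hbits
  obtain ⟨r, hr, -⟩ := hrate (by linarith)
  exact exists_isErrorGuessRate ⟨r, hr⟩

theorem exists_sub_syndromeBits_sub_le_mul_rate (h0 : 0 < δ) (h1 : δ ≤ 3 / 4)
    (hz : normalCDF z = 1 - ε) :
    ∃ K : ℝ, ∀ᶠ n : ℕ in atTop, ∀ R, IsErrorGuessRate (depolarizingLaw n δ) ε R →
      n - syndromeBits δ z n - K ≤ n * R := by
  rcases h1.eq_or_lt with rfl | hδ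
  · have hneg : hashingBound (3 / 4) < 0 := by
      rw [hashingBound_three_quarters]
      norm_num
    refine ⟨0, ?_⟩
    filter_upwards [eventually_sub_syndromeBits_nonpos h0 (by norm_num) hneg z] with n hn R hR
    linarith [mul_nonneg n.cast_nonneg hR.nonneg]
  · obtain ⟨K, hK⟩ := exists_mem_guessRates_ge h0 hδ hz
    refine ⟨K + 1, ?_⟩
    filter_upwards [hK] with n hrate R hR
    rcases le_or_gt (syndromeBits δ z n + K) n with hle | hlt
    · obtain ⟨r, hr, hnr⟩ := hrate hle
      exact hnr.trans (mul_le_mul_of_nonneg_left (hR.2 hr) n.cast_nonneg)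
    · linarith [mul_nonneg n.cast_nonneg hR.nonneg]

theorem exists_mul_rate_le_sub_syndromeBits_add (h0 : 0 < δ) (h1 : δ ≤ 3 / 4)
    (hz : normalCDF z = 1 - ε) :
    ∃ K : ℝ, ∀ᶠ n : ℕ in atTop, ∀ R, IsErrorGuessRate (depolarizingLaw n δ) ε R →
      n * R ≤ n - syndromeBits δ z n + K := by
  obtain ⟨K, hK⟩ := exists_syndromeBits_sub_le_of_guessErrorProb_le h0 h1 hz
  refine ⟨K, ?_⟩
  filter_upwards [hK, eventually_ne_atTop 0] with n hbits hn
  rintro R ⟨⟨m, k, hmk, rfl, C, -, D, hD⟩, -⟩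
  have hm := hbits m _ C D hD
  have hsum : (m : ℝ) + k = n := by exact_mod_cast hmk
  rw [mul_div_cancel₀ _ (Nat.cast_ne_zero.2 hn)]
  linarith

theorem exists_rate_expansion (h0 : 0 < δ) (h1 : δ ≤ 3 / 4) (hε0 : 0 < ε) (hε1 : ε < 1) :
    ∃ (K : ℝ) (N : ℕ), ∀ n : ℕ, N ≤ n →
      (0 < hashingBound δ → ∃ R, IsErrorGuessRate (depolarizingLaw n δ) ε R) ∧
      ∀ R, IsErrorGuessRate (depolarizingLaw n δ) ε R →
        |R - (hashingBound δ
              - Real.sqrt (δ * (1 - δ) / n) * normalCDFInv ε * Real.logb 2 (δ / (3 * (1 - δ)))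
              + Real.logb 2 n / (2 * n))| ≤ K / n := by
  have hz : normalCDF (-normalCDFInv ε) = 1 - ε := by
    rw [normalCDF_neg, normalCDF_normalCDFInv hε0 hε1]
  obtain ⟨K₁, hlower⟩ := exists_sub_syndromeBits_sub_le_mul_rate h0 h1 hz
  obtain ⟨K₂, hupper⟩ := exists_mul_rate_le_sub_syndromeBits_add h0 h1 hz
  refine ⟨max K₁ K₂, eventually_atTop.1 ?_⟩
  filter_upwards [eventually_imp_distrib_left.2 (eventually_exists_isErrorGuessRate h0 h1 hz),
    hlower, hupper, eventually_ne_atTop 0] with n hexists hge hle hn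
  refine ⟨hexists, fun R hR => ?_⟩
  have hn' : (0 : ℝ) < n := by positivity
  specialize hge R hR
  specialize hle R hR
  rw [sub_syndromeBits h0 (by linarith) _ hn] at hge hle
  rw [le_div_iff₀' hn', ← abs_of_pos hn', ← abs_mul, abs_of_pos hn', mul_sub, abs_le]
  constructor <;> linarith [le_max_left K₁ K₂, le_max_right K₁ K₂]

end Rate

end PauliGuess

end

theorem mainTheorem4 (δ : ℝ) (hδ0 : 0 ≤ δ) (hδ1 : δ ≤ 3 / 4) :
    (∀ n m k : ℕ, 0 < n → m + k = n →
      ∀ o : Fin (2 ^ (2 * n)) ≃ PauliGuess.PVec n,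
        PauliGuess.IsSortedOrder (PauliGuess.depolarizingLaw n δ) o →
        ∀ ℓ : ℝ, ℓ = PauliGuess.binCDFInv n (3 / 4) ((2 : ℝ) ^ m / 4 ^ n) →
          PauliGuess.errorConverse (PauliGuess.depolarizingLaw n δ) o m
              = PauliGuess.binCDF n (1 - δ) (n - 1 - ℓ) ∧
          PauliGuess.errorAchievability (PauliGuess.depolarizingLaw n δ) o m
              = (1 + 1 / (2 : ℝ) ^ (m + 1)) * PauliGuess.binCDF n (1 - δ) (n - 1 - ℓ)
                - 1 / (2 : ℝ) ^ (m + 1)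
                + (2 : ℝ) ^ ((m : ℤ) - 1) * (1 - δ) ^ n * (δ / (3 - 3 * δ)) ^ (⌊ℓ⌋ + 1)
                + (16 - 16 * δ) ^ n / (2 : ℝ) ^ (m + 1) * ((3 - 4 * δ) / (3 - 3 * δ))
                  * ∑ i ∈ Finset.range (⌊ℓ⌋₊ + 1),
                      (δ / (3 - 3 * δ)) ^ i * PauliGuess.binCDF n (3 / 4) i ^ 2) ∧
    (0 < δ → ∀ ε : ℝ, 0 < ε → ε < 1 →
      ∃ (K : ℝ) (N : ℕ), ∀ n : ℕ, N ≤ n →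
        (0 < PauliGuess.hashingBound δ →
          ∃ R, PauliGuess.IsErrorGuessRate (PauliGuess.depolarizingLaw n δ) ε R) ∧
        ∀ R, PauliGuess.IsErrorGuessRate (PauliGuess.depolarizingLaw n δ) ε R →
          |R - (PauliGuess.hashingBound δ
                - Real.sqrt (δ * (1 - δ) / n) * PauliGuess.normalCDFInv ε
                  * Real.logb 2 (δ / (3 * (1 - δ)))
                + Real.logb 2 n / (2 * n))| ≤ K / n) := by
  refine ⟨fun n m k hn hmk o ho ℓ hℓ => ?_, fun hδ ε hε0 hε1 =>
    PauliGuess.exists_rate_expansion hδ hδ1 hε0 hε1⟩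
  have hm : 2 ^ m < 4 ^ n := by
    rw [show (4 : ℕ) = 2 ^ 2 from rfl, ← pow_mul]
    exact Nat.pow_lt_pow_right (by norm_num) (by omega)
  exact ⟨PauliGuess.errorConverse_depolarizingLaw hδ0 hδ1 ho hm hℓ,
    PauliGuess.errorAchievability_depolarizingLaw hδ0 hδ1 ho hm hℓ⟩
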